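/- Let $\mathbb{D}$ be the open unit disc and let $H(\mathbb{D})$ be the space of holomorphic functions on $\mathbb{D}$. For $\gamma>0$ let $$A^{-\gamma}=\Big\{f\in H(\mathbb{D}) : \|f\|_{-\gamma}:=\sup_{z\in\mathbb{D}}(1-|z|)^\gamma|f(z)|<\infty\Big\},\qquad A_0^{-\gamma}=\Big\{f\in H(\mathbb{D}) : \lim_{|z|\to1^-}(1-|z|)^\gamma|f(z)|=0\Big\}\subseteq A^{-\gamma},$$ both equipped with the norm $\|\cdot\|_{-\gamma}$. The Cesàro operator, $C(f)(z)=\frac1z\int_0^z\frac{f(\zeta)}{1-\zeta}\,d\zeta$ for $z\in\mathbb{D}\setminus\{0\}$ and $C(f)(0)=f(0)$, acts continuously in $A^{-\gamma}$ and in $A_0^{-\gamma}$, where it is denoted by $C_\gamma$ and $C_{\gamma,0}$ respectively. For a bounded linear operator $T$ on a normed space $X$ put $T_{[n]}=\frac1n\sum_{m=1}^nT^m$ for $n\ge1$. The operator $T$ is power bounded if $\sup_n\|T^n\|<\infty$; mean ergodic if there is a bounded linear operator $P$ on $X$ with $T_{[n]}x\to Px$ for every $x\in X$; and uniformly mean ergodic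 if there is a bounded linear operator $P$ on $X$ with $\|T_{[n]}-P\|\to0$. **Theorem.** (i) Let $0<\gamma<1$. Both $C_\gamma$ and $C_{\gamma,0}$ fail to be power bounded and are not mean ergodic. Moreover, $\ker(I-C_\gamma)=\{0\}$ and $\ker(I-C_{\gamma,0})=\{0\}$, and $\operatorname{Im}(I-C_\gamma)$ (resp. $\operatorname{Im}(I-C_{\gamma,0})$) is a proper closed subspace of $A^{-\gamma}$ (resp. of $A_0^{-\gamma}$). (ii) Both $C_1$ and $C_{1,0}$ are power bounded but not mean ergodic. Moreover, $\operatorname{Im}(I-C_1)$ (resp. $\operatorname{Im}(I-C_{1,0})$) is not a closed subspace of $A^{-1}$ (resp. of $A_0^{-1}$). (iii) Let $\gamma>1$. Both $C_\gamma$ and $C_{\gamma,0}$ are power bounded and uniformly mean ergodic. Moreover, $\operatorname{Im}(I-C_\gamma)$ (resp. $\operatorname{Im}(I-C_{\gamma,0})$) is a proper closed subspace of $A^{-\gamma}$ (resp. of $A_0^{-\gamma}$), and $\operatorname{Im}(I-C_\gamma)=\{h\in A^{-\gamma} : h(0)=0\}$. In addition, with $\varphi(z)=\frac{1}{1-z}$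 for $z\in\mathbb{D}$, the map $P_\gamma(f)=f(0)\varphi$ is a continuous linear projection of $A^{-\gamma}$ into itself, and $\lim_{n\to\infty}\|(C_\gamma)_{[n]}-P_\gamma\|=0$. -/

import Mathlib

open Filter Topology
open scoped Complex.UnitDisc

/-! ### Holomorphic functions on the open unit disc and the Cesàro operator -/

/-- A function on the open unit disc, extended by `0` to the whole plane. Only its values on the
disc are ever relevant. -/
noncomputable def discExtend (f : 𝔻 → ℂ) : ℂ → ℂ :=
  Function.extend (fun z : 𝔻 => (z : ℂ)) f 0

/-- `f ∈ H(𝔻)`: the function `f` is holomorphic on the open unit disc. -/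
def HolomorphicOnDisc (f : 𝔻 → ℂ) : Prop :=
  DifferentiableOn ℂ (discExtend f) (Metric.ball (0 : ℂ) 1)

/-- The classical Cesàro operator: `C f (0) = f (0)` and, for `z ≠ 0`,
`C f (z) = (1 / z) ∫_0^z f (ζ) / (1 - ζ) dζ`. The path integral is taken along the segment
`ζ = t z`, `0 ≤ t ≤ 1`, so that `dζ = z dt`. -/
noncomputable def cesaro (f : 𝔻 → ℂ) (z : 𝔻) : ℂ :=
  if (z : ℂ) = 0 then f z
  else (z : ℂ)⁻¹ * ∫ t in (0 : ℝ)..1, discExtend f (t * z) / (1 - t * z) * z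

theorem discExtend_coe (f : 𝔻 → ℂ) (z : 𝔻) : discExtend f z = f z :=
  Complex.UnitDisc.coe_injective.extend_apply f 0 z

theorem discExtend_eqOn {f : 𝔻 → ℂ} {F : ℂ → ℂ} (h : ∀ z : 𝔻, f z = F z) :
    Set.EqOn (discExtend f) F (Metric.ball (0 : ℂ) 1) := by
  intro z hz
  lift z to 𝔻 using by simpa using hz
  rw [discExtend_coe, h]

theorem HolomorphicOnDisc.zero : HolomorphicOnDisc 0 :=
  (differentiableOn_const (0 : ℂ)).congr (discExtend_eqOn fun _ => rfl)

theorem HolomorphicOnDisc.add {f g : 𝔻 → ℂ} (hf : HolomorphicOnDisc f)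
    (hg : HolomorphicOnDisc g) : HolomorphicOnDisc (f + g) :=
  (DifferentiableOn.add hf hg).congr (discExtend_eqOn fun z => by simp [discExtend_coe])

theorem HolomorphicOnDisc.smul {f : 𝔻 → ℂ} (c : ℂ) (hf : HolomorphicOnDisc f) :
    HolomorphicOnDisc (c • f) :=
  (DifferentiableOn.const_smul hf c).congr (discExtend_eqOn fun z => by simp [discExtend_coe])

/-! ### The growth space `A^{-γ}` -/

theorem one_sub_norm_pos (z : 𝔻) : 0 < 1 - ‖(z : ℂ)‖ := sub_pos.2 z.norm_lt_one

/-- The weighted modulus `(1 - |z|)^γ |f z|`. -/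
noncomputable def growthWeight (γ : ℝ) (f : 𝔻 → ℂ) (z : 𝔻) : ℝ :=
  (1 - ‖(z : ℂ)‖) ^ γ * ‖f z‖

theorem growthWeight_nonneg (γ : ℝ) (f : 𝔻 → ℂ) (z : 𝔻) : 0 ≤ growthWeight γ f z :=
  mul_nonneg (Real.rpow_nonneg (one_sub_norm_pos z).le _) (norm_nonneg _)

theorem growthWeight_add_le (γ : ℝ) (f g : 𝔻 → ℂ) (z : 𝔻) :
    growthWeight γ (f + g) z ≤ growthWeight γ f z + growthWeight γ g z := by
  unfold growthWeight
  rw [← mul_add]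
  exact mul_le_mul_of_nonneg_left (norm_add_le _ _) (Real.rpow_nonneg (one_sub_norm_pos z).le _)

theorem growthWeight_smul (γ : ℝ) (c : ℂ) (f : 𝔻 → ℂ) (z : 𝔻) :
    growthWeight γ (c • f) z = ‖c‖ * growthWeight γ f z := by
  simp only [growthWeight, Pi.smul_apply, norm_smul]
  ring

/-- The set of all `f ∈ H(𝔻)` with `sup_z (1 - |z|)^γ |f z| < ∞`, as a linear subspace of the
space of all functions on the disc. -/
def growthSubmodule (γ : ℝ) : Submodule ℂ (𝔻 → ℂ) where
  carrier := {f | HolomorphicOnDisc f ∧ BddAbove (Set.range (growthWeight γ f))}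
  zero_mem' := ⟨HolomorphicOnDisc.zero, 0, by
    rintro _ ⟨z, rfl⟩
    simp [growthWeight]⟩
  add_mem' := by
    rintro f g ⟨hf, A, hA⟩ ⟨hg, B, hB⟩
    refine ⟨hf.add hg, A + B, ?_⟩
    rintro _ ⟨z, rfl⟩
    exact (growthWeight_add_le γ f g z).trans (add_le_add (hA ⟨z, rfl⟩) (hB ⟨z, rfl⟩))
  smul_mem' := by
    rintro c f ⟨hf, A, hA⟩
    refine ⟨hf.smul c, ‖c‖ * A, ?_⟩
    rintro _ ⟨z, rfl⟩
    rw [growthWeight_smul]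
    exact mul_le_mul_of_nonneg_left (hA ⟨z, rfl⟩) (norm_nonneg c)

/-- The growth space `A^{-γ}`. It is a type of its own (rather than the coercion of
`growthSubmodule γ`) so that its only topology is the one of the norm below. -/
def GrowthSpace (γ : ℝ) : Type := growthSubmodule γ

namespace GrowthSpace

noncomputable instance (γ : ℝ) : AddCommGroup (GrowthSpace γ) :=
  inferInstanceAs (AddCommGroup (growthSubmodule γ))

noncomputable instance (γ : ℝ) : Module ℂ (GrowthSpace γ) :=
  inferInstanceAs (Module ℂ (growthSubmodule γ))

instance (γ : ℝ) : CoeFun (GrowthSpace γ) (fun _ => 𝔻 → ℂ) := ⟨fun f => f.1⟩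

variable {γ : ℝ}

@[ext] theorem ext {f g : GrowthSpace γ} (h : ∀ z, f z = g z) : f = g :=
  Subtype.ext (funext h)

@[simp] theorem zero_apply (z : 𝔻) : (0 : GrowthSpace γ) z = 0 := rfl

@[simp] theorem add_apply (f g : GrowthSpace γ) (z : 𝔻) : (f + g) z = f z + g z := rfl

@[simp] theorem smul_apply (c : ℂ) (f : GrowthSpace γ) (z : 𝔻) : (c • f) z = c * f z := rfl

theorem holomorphic (f : GrowthSpace γ) : HolomorphicOnDisc f := f.2.1

theorem bddAbove (f : GrowthSpace γ) : BddAbove (Set.range (growthWeight γ f)) := f.2.2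

/-- The norm `‖f‖_{-γ} = sup_z (1 - |z|)^γ |f z|`. -/
noncomputable instance : Norm (GrowthSpace γ) := ⟨fun f => ⨆ z : 𝔻, growthWeight γ f z⟩

theorem norm_def (f : GrowthSpace γ) : ‖f‖ = ⨆ z : 𝔻, growthWeight γ f z := rfl

theorem growthWeight_le_norm (f : GrowthSpace γ) (z : 𝔻) : growthWeight γ f z ≤ ‖f‖ :=
  le_ciSup f.bddAbove z

theorem norm_le_of_growthWeight_le {f : GrowthSpace γ} {A : ℝ}
    (h : ∀ z, growthWeight γ f z ≤ A) : ‖f‖ ≤ A :=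
  ciSup_le h

theorem norm_apply_le (f : GrowthSpace γ) (z : 𝔻) :
    ‖f z‖ ≤ ‖f‖ * (1 - ‖(z : ℂ)‖) ^ (-γ) := by
  have hp := Real.rpow_pos_of_pos (one_sub_norm_pos z) γ
  rw [Real.rpow_neg (one_sub_norm_pos z).le, ← div_eq_mul_inv, le_div_iff₀ hp, mul_comm]
  exact f.growthWeight_le_norm z

theorem core : NormedSpace.Core ℂ (GrowthSpace γ) where
  norm_nonneg f := (growthWeight_nonneg γ f 0).trans (f.growthWeight_le_norm 0)
  norm_smul c f := by
    have h : ∀ z, growthWeight γ (c • f) z = ‖c‖ * growthWeight γ f z :=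
      growthWeight_smul γ c f
    rw [norm_def, norm_def, Real.mul_iSup_of_nonneg (norm_nonneg c)]
    exact iSup_congr h
  norm_triangle f g := norm_le_of_growthWeight_le fun z =>
    (growthWeight_add_le γ f g z).trans
      (add_le_add (f.growthWeight_le_norm z) (g.growthWeight_le_norm z))
  norm_eq_zero_iff f := by
    constructor
    · intro h
      ext z
      have := f.norm_apply_le z
      rw [h, zero_mul] at this
      simpa using this
    · rintro rfl
      simp [norm_def, growthWeight]

noncomputable instance : NormedAddCommGroup (GrowthSpace γ) := NormedAddCommGroup.ofCore core

noncomputable instance : NormedSpace ℂ (GrowthSpace γ) := NormedSpace.ofCore core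

end GrowthSpace

/-! ### The little growth space `A_0^{-γ}` -/

/-- `(1 - |z|)^γ |f z| → 0` as `|z| → 1⁻`. -/
def VanishingGrowth (γ : ℝ) (f : 𝔻 → ℂ) : Prop :=
  Tendsto (growthWeight γ f) (comap (fun z : 𝔻 => ‖(z : ℂ)‖) (𝓝[<] 1)) (𝓝 0)

/-- The subspace `A_0^{-γ}` of `A^{-γ}`, with the norm of `A^{-γ}`. Every holomorphic function
with vanishing growth automatically lies in `A^{-γ}`, see `mem_growthSubmodule_of_vanishing`. -/
def GrowthSpaceZero (γ : ℝ) : Submodule ℂ (GrowthSpace γ) where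
  carrier := {f | VanishingGrowth γ f}
  zero_mem' := by
    have : growthWeight γ (0 : GrowthSpace γ) = fun _ => 0 := by
      funext z; simp [growthWeight]
    change Tendsto (growthWeight γ (0 : GrowthSpace γ)) _ _
    rw [this]
    exact tendsto_const_nhds
  add_mem' := by
    intro f g hf hg
    have hf' : VanishingGrowth γ f := hf
    have hg' : VanishingGrowth γ g := hg
    have h := Tendsto.add hf' hg'
    rw [add_zero] at h
    exact squeeze_zero (growthWeight_nonneg γ _) (growthWeight_add_le γ f g) h
  smul_mem' := by
    intro c f hf
    have hf' : VanishingGrowth γ f := hf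
    have h := Tendsto.const_mul ‖c‖ hf'
    rw [mul_zero] at h
    exact h.congr fun z => (growthWeight_smul γ c f z).symm

theorem vanishingGrowth_iff {γ : ℝ} {f : 𝔻 → ℂ} :
    VanishingGrowth γ f ↔
      ∀ ε > 0, ∃ r < 1, ∀ z : 𝔻, r < ‖(z : ℂ)‖ → growthWeight γ f z ≤ ε := by
  have key : ∀ p : 𝔻 → Prop,
      (∀ᶠ z in comap (fun z : 𝔻 => ‖(z : ℂ)‖) (𝓝[<] (1 : ℝ)), p z) ↔
        ∃ r < 1, ∀ z : 𝔻, r < ‖(z : ℂ)‖ → p z := by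
    intro p
    rw [((nhdsLT_basis (1 : ℝ)).comap fun z : 𝔻 => ‖(z : ℂ)‖).eventually_iff]
    refine exists_congr fun r => and_congr_right fun _ => ?_
    exact ⟨fun h z hz => h ⟨hz, z.norm_lt_one⟩, fun h z hz => h z hz.1⟩
  unfold VanishingGrowth
  rw [Metric.tendsto_nhds]
  simp only [key, Real.dist_eq, sub_zero, abs_of_nonneg (growthWeight_nonneg γ f _)]
  constructor
  · intro h ε hε
    obtain ⟨r, hr, H⟩ := h ε hε
    exact ⟨r, hr, fun z hz => (H z hz).le⟩
  · intro h ε hε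
    obtain ⟨r, hr, H⟩ := h (ε / 2) (by linarith)
    exact ⟨r, hr, fun z hz => (H z hz).trans_lt (by linarith)⟩

theorem mem_growthSubmodule_of_vanishing {γ : ℝ} (hγ : 0 < γ) {f : 𝔻 → ℂ}
    (hf : HolomorphicOnDisc f) (h : VanishingGrowth γ f) : f ∈ growthSubmodule γ := by
  refine ⟨hf, ?_⟩
  obtain ⟨r, hr, H⟩ := vanishingGrowth_iff.1 h 1 one_pos
  have hsub : Metric.closedBall (0 : ℂ) r ⊆ Metric.ball 0 1 := Metric.closedBall_subset_ball hr
  obtain ⟨M, hM⟩ := (isCompact_closedBall (0 : ℂ) r).exists_bound_of_continuousOn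
    (hf.continuousOn.mono hsub)
  refine ⟨max 1 M, ?_⟩
  rintro _ ⟨z, rfl⟩
  rcases lt_or_ge r ‖(z : ℂ)‖ with hz | hz
  · exact (H z hz).trans (le_max_left _ _)
  · have h1 := hM z (by simpa using hz)
    rw [discExtend_coe] at h1
    have h2 : (1 - ‖(z : ℂ)‖) ^ γ ≤ 1 :=
      Real.rpow_le_one (one_sub_norm_pos z).le (by linarith [norm_nonneg (z : ℂ)]) hγ.le
    have h3 : growthWeight γ f z ≤ 1 * ‖f z‖ := mul_le_mul_of_nonneg_right h2 (norm_nonneg _)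
    rw [one_mul] at h3
    exact (h3.trans h1).trans (le_max_right _ _)

/-! ### The Cesàro operator acts in the growth spaces -/

theorem cesaro_eq_integral (f : 𝔻 → ℂ) (z : 𝔻) :
    cesaro f z = ∫ t in (0 : ℝ)..1, discExtend f (t * z) / (1 - t * z) := by
  unfold cesaro
  split_ifs with h
  · rw [← discExtend_coe f z, h]
    simp
  · rw [intervalIntegral.integral_mul_const]
    field_simp

theorem ofReal_mul_mem_ball {z : ℂ} (hz : ‖z‖ < 1) {t : ℝ} (ht : t ∈ Set.Icc (0 : ℝ) 1) :
    (t : ℂ) * z ∈ Metric.ball (0 : ℂ) 1 := by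
  rw [mem_ball_zero_iff, norm_mul, Complex.norm_real, Real.norm_of_nonneg ht.1]
  exact (mul_le_of_le_one_left (norm_nonneg z) ht.2).trans_lt hz

theorem one_sub_ne_zero_of_mem_ball {w : ℂ} (hw : w ∈ Metric.ball (0 : ℂ) 1) : 1 - w ≠ 0 := by
  intro h
  rw [mem_ball_zero_iff, ← sub_eq_zero.1 h] at hw
  simp at hw

theorem differentiableOn_div_one_sub {f : 𝔻 → ℂ} (hf : HolomorphicOnDisc f) :
    DifferentiableOn ℂ (fun w => discExtend f w / (1 - w)) (Metric.ball 0 1) :=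
  DifferentiableOn.div hf (by fun_prop) fun _ hw => one_sub_ne_zero_of_mem_ball hw

theorem continuousOn_radial {f : 𝔻 → ℂ} (hf : HolomorphicOnDisc f) (z : 𝔻) :
    ContinuousOn (fun t : ℝ => discExtend f (t * z) / (1 - t * z)) (Set.Icc 0 1) :=
  (differentiableOn_div_one_sub hf).continuousOn.comp (f := fun t : ℝ => (t : ℂ) * (z : ℂ))
    (by fun_prop) fun _ ht => ofReal_mul_mem_ball z.norm_lt_one ht

theorem HolomorphicOnDisc.cesaro {f : 𝔻 → ℂ} (hf : HolomorphicOnDisc f) :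
    HolomorphicOnDisc (cesaro f) := by
  obtain ⟨G, hG⟩ := (differentiableOn_div_one_sub hf).isExactOn_ball
  have hGd : DifferentiableOn ℂ G (Metric.ball 0 1) := fun z hz =>
    (hG z hz).differentiableAt.differentiableWithinAt
  have hd := (Complex.differentiableOn_dslope
    (Metric.ball_mem_nhds (0 : ℂ) one_pos)).2 hGd
  refine hd.congr (discExtend_eqOn fun z => ?_)
  by_cases h : (z : ℂ) = 0
  · have h0 := (hG 0 (by simp)).deriv
    rw [_root_.cesaro, if_pos h, h, dslope_same, h0, ← discExtend_coe f z, h]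
    simp
  · rw [_root_.cesaro, if_neg h, dslope_of_ne _ h, slope_def_field]
    have : ∫ t in (0 : ℝ)..1, discExtend f (t * z) / (1 - t * z) * z = G z - G 0 := by
      have := intervalIntegral.integral_eq_sub_of_hasDerivAt (a := 0) (b := 1)
        (f := fun t : ℝ => G (t * z))
        (f' := fun t : ℝ => discExtend f (t * z) / (1 - t * z) * z) ?_ ?_
      · simpa using this
      · intro t ht
        rw [Set.uIcc_of_le zero_le_one] at ht
        have h1 := hG _ (ofReal_mul_mem_ball z.norm_lt_one ht)
        have h2 : HasDerivAt (fun t : ℝ => (t : ℂ) * (z : ℂ)) (z : ℂ) t := by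
          simpa using (Complex.ofRealCLM.hasDerivAt (x := t)).mul_const (z : ℂ)
        exact h1.comp t h2
      · apply ContinuousOn.intervalIntegrable
        rw [Set.uIcc_of_le zero_le_one]
        exact (continuousOn_radial hf z).mul continuousOn_const
    rw [this, sub_zero, div_eq_inv_mul]

theorem cesaro_add {f g : 𝔻 → ℂ} (hf : HolomorphicOnDisc f) (hg : HolomorphicOnDisc g) (z : 𝔻) :
    cesaro (f + g) z = cesaro f z + cesaro g z := by
  have hi : ∀ {f : 𝔻 → ℂ}, HolomorphicOnDisc f → IntervalIntegrable
      (fun t : ℝ => discExtend f (t * z) / (1 - t * z)) MeasureTheory.volume 0 1 := by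
    intro f hf
    apply ContinuousOn.intervalIntegrable
    rw [Set.uIcc_of_le zero_le_one]
    exact continuousOn_radial hf z
  rw [cesaro_eq_integral, cesaro_eq_integral, cesaro_eq_integral,
    ← intervalIntegral.integral_add (hi hf) (hi hg)]
  refine intervalIntegral.integral_congr fun t ht => ?_
  rw [Set.uIcc_of_le zero_le_one] at ht
  have := discExtend_eqOn (f := f + g) (F := discExtend f + discExtend g)
    (fun z => by simp [discExtend_coe]) (ofReal_mul_mem_ball z.norm_lt_one ht)
  simp only [this, Pi.add_apply, add_div]

theorem cesaro_smul (c : ℂ) (f : 𝔻 → ℂ) (z : 𝔻) : cesaro (c • f) z = c * cesaro f z := by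
  rw [cesaro_eq_integral, cesaro_eq_integral, ← intervalIntegral.integral_const_mul]
  refine intervalIntegral.integral_congr fun t ht => ?_
  rw [Set.uIcc_of_le zero_le_one] at ht
  have := discExtend_eqOn (f := c • f) (F := c • discExtend f)
    (fun z => by simp [discExtend_coe]) (ofReal_mul_mem_ball z.norm_lt_one ht)
  simp only [this, Pi.smul_apply, smul_eq_mul, mul_div_assoc]

theorem one_sub_mul_pos {s : ℝ} (hs0 : 0 ≤ s) (hs1 : s < 1) {t : ℝ} (ht : t ∈ Set.Icc (0 : ℝ) 1) :
    0 < 1 - t * s := by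
  nlinarith [ht.1, ht.2]

theorem continuousOn_kernel (γ : ℝ) {s : ℝ} (hs0 : 0 ≤ s) (hs1 : s < 1) :
    ContinuousOn (fun t : ℝ => (1 - t * s) ^ (-γ - 1)) (Set.Icc 0 1) :=
  ContinuousOn.rpow_const (by fun_prop) fun _ ht => Or.inl (one_sub_mul_pos hs0 hs1 ht).ne'

theorem integral_kernel_le {γ : ℝ} (hγ : 0 < γ) {s : ℝ} (hs0 : 0 ≤ s) (hs1 : s < 1) :
    ∫ t in (0 : ℝ)..1, (1 - t * s) ^ (-γ - 1) ≤
      (2 ^ (γ + 1) + 2 / γ) * (1 - s) ^ (-γ) := by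
  have hint : IntervalIntegrable (fun t : ℝ => (1 - t * s) ^ (-γ - 1))
      MeasureTheory.volume 0 1 := by
    apply ContinuousOn.intervalIntegrable
    rw [Set.uIcc_of_le zero_le_one]
    exact continuousOn_kernel γ hs0 hs1
  have h1 : (1 : ℝ) ≤ (1 - s) ^ (-γ) :=
    Real.one_le_rpow_of_pos_of_le_one_of_nonpos (by linarith) (by linarith) (by linarith)
  have hA : (0 : ℝ) < 2 ^ (γ + 1) := by positivity
  have hB : (0 : ℝ) < 2 / γ := by positivity
  rcases le_or_gt s (1 / 2) with hs | hs
  · have h2 : ∫ t in (0 : ℝ)..1, (1 - t * s) ^ (-γ - 1) ≤ ∫ t in (0 : ℝ)..1, (2 : ℝ) ^ (γ + 1) := by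
      refine intervalIntegral.integral_mono_on zero_le_one hint (by simp) fun t ht => ?_
      have h3 : (1 / 2 : ℝ) ≤ 1 - t * s := by nlinarith [ht.1, ht.2]
      have h4 := Real.rpow_le_rpow_of_nonpos (by norm_num) h3 (by linarith : -γ - 1 ≤ 0)
      refine h4.trans_eq ?_
      rw [one_div, Real.inv_rpow zero_le_two, ← Real.rpow_neg zero_le_two]
      rw [neg_sub, sub_neg_eq_add, add_comm]
    rw [intervalIntegral.integral_const, sub_zero, one_smul] at h2
    nlinarith
  · have h2 : ∫ t in (0 : ℝ)..1, (1 - t * s) ^ (-γ - 1) * (γ * s) = (1 - s) ^ (-γ) - 1 := by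
      have := intervalIntegral.integral_eq_sub_of_hasDerivAt (a := 0) (b := 1)
        (f := fun t : ℝ => (1 - t * s) ^ (-γ))
        (f' := fun t : ℝ => (1 - t * s) ^ (-γ - 1) * (γ * s)) ?_ (hint.mul_const _)
      · simpa using this
      · intro t ht
        rw [Set.uIcc_of_le zero_le_one] at ht
        have h3 : HasDerivAt (fun t : ℝ => 1 - t * s) (-s) t := by
          simpa using ((hasDerivAt_id t).mul_const s).const_sub 1
        have h4 := h3.rpow_const (p := -γ) (Or.inl (one_sub_mul_pos hs0 hs1 ht).ne')
        exact h4.congr_deriv (by ring)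
    rw [intervalIntegral.integral_mul_const] at h2
    have h5 : 0 < γ * s := by positivity
    have h6 : ∫ t in (0 : ℝ)..1, (1 - t * s) ^ (-γ - 1) = ((1 - s) ^ (-γ) - 1) / (γ * s) := by
      rw [← h2, mul_div_cancel_right₀ _ h5.ne']
    have h7 : ((1 - s) ^ (-γ) - 1) / (γ * s) ≤ 2 / γ * (1 - s) ^ (-γ) := by
      rw [div_le_iff₀ h5]
      have : 2 / γ * (1 - s) ^ (-γ) * (γ * s) = 2 * s * (1 - s) ^ (-γ) := by field_simp
      rw [this]
      nlinarith
    rw [h6]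
    nlinarith

theorem norm_cesaro_le {γ δ A B : ℝ} (hγ : 0 < γ) (hδ : 0 < δ) (hA : 0 ≤ A) (hB : 0 ≤ B)
    {f : 𝔻 → ℂ}
    (h : ∀ z : 𝔻, ‖f z‖ ≤ A * (1 - ‖(z : ℂ)‖) ^ (-γ) + B * (1 - ‖(z : ℂ)‖) ^ (-δ)) (z : 𝔻) :
    ‖cesaro f z‖ ≤ A * ((2 ^ (γ + 1) + 2 / γ) * (1 - ‖(z : ℂ)‖) ^ (-γ)) +
      B * ((2 ^ (δ + 1) + 2 / δ) * (1 - ‖(z : ℂ)‖) ^ (-δ)) := by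
  have hs0 := norm_nonneg (z : ℂ)
  have hs1 := z.norm_lt_one
  have hint : ∀ η : ℝ, IntervalIntegrable (fun t : ℝ => (1 - t * ‖(z : ℂ)‖) ^ (-η - 1))
      MeasureTheory.volume 0 1 := by
    intro η
    apply ContinuousOn.intervalIntegrable
    rw [Set.uIcc_of_le zero_le_one]
    exact continuousOn_kernel η hs0 hs1
  rw [cesaro_eq_integral]
  refine (intervalIntegral.norm_integral_le_of_norm_le zero_le_one
    (g := fun t : ℝ => A * (1 - t * ‖(z : ℂ)‖) ^ (-γ - 1) + B * (1 - t * ‖(z : ℂ)‖) ^ (-δ - 1))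
    (Filter.Eventually.of_forall fun t ht => ?_)
    (((hint γ).const_mul A).add ((hint δ).const_mul B))).trans ?_
  · have ht' : t ∈ Set.Icc (0 : ℝ) 1 := ⟨ht.1.le, ht.2⟩
    have hb := ofReal_mul_mem_ball hs1 ht'
    obtain ⟨w, hw⟩ : ∃ w : 𝔻, (w : ℂ) = t * z :=
      ⟨Complex.UnitDisc.mk _ (by simpa using hb), rfl⟩
    have hn : ‖(w : ℂ)‖ = t * ‖(z : ℂ)‖ := by
      rw [hw, norm_mul, Complex.norm_real, Real.norm_of_nonneg ht'.1]
    have hp := one_sub_mul_pos hs0 hs1 ht'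
    have h1 := h w
    rw [hn] at h1
    rw [← hw, discExtend_coe, norm_div]
    have h2 : 1 - t * ‖(z : ℂ)‖ ≤ ‖1 - (w : ℂ)‖ := by
      rw [← hn]
      simpa using norm_sub_norm_le (1 : ℂ) w
    refine (div_le_div₀ ((norm_nonneg _).trans h1) h1 hp h2).trans_eq ?_
    rw [Real.rpow_sub_one hp.ne', Real.rpow_sub_one hp.ne']
    ring
  · rw [intervalIntegral.integral_add ((hint γ).const_mul A) ((hint δ).const_mul B),
      intervalIntegral.integral_const_mul, intervalIntegral.integral_const_mul]
    exact add_le_add (mul_le_mul_of_nonneg_left (integral_kernel_le hγ hs0 hs1) hA)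
      (mul_le_mul_of_nonneg_left (integral_kernel_le hδ hs0 hs1) hB)

theorem growthWeight_cesaro_le {γ : ℝ} (hγ : 0 < γ) (f : GrowthSpace γ) (z : 𝔻) :
    growthWeight γ (cesaro f) z ≤ (2 ^ (γ + 1) + 2 / γ) * ‖f‖ := by
  have h := norm_cesaro_le hγ hγ (norm_nonneg f) le_rfl (f := f)
    (fun z => by simpa using f.norm_apply_le z) z
  have hp := Real.rpow_pos_of_pos (one_sub_norm_pos z) γ
  rw [zero_mul, add_zero, Real.rpow_neg (one_sub_norm_pos z).le] at h
  calc growthWeight γ (cesaro f) z ≤ (1 - ‖(z : ℂ)‖) ^ γ * _ := mul_le_mul_of_nonneg_left h hp.le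
    _ = _ := by field_simp

/-- The Cesàro operator `C_γ : A^{-γ} → A^{-γ}` as a bounded operator. -/
noncomputable def cesaroGrowth (γ : ℝ) (hγ : 0 < γ) : GrowthSpace γ →L[ℂ] GrowthSpace γ :=
  LinearMap.mkContinuous
    { toFun := fun f => ⟨cesaro f, f.holomorphic.cesaro, _, by
        rintro _ ⟨z, rfl⟩
        exact growthWeight_cesaro_le hγ f z⟩
      map_add' := fun f g => GrowthSpace.ext fun z => cesaro_add f.holomorphic g.holomorphic z
      map_smul' := fun c f => GrowthSpace.ext fun z => cesaro_smul c f z }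
    (2 ^ (γ + 1) + 2 / γ)
    fun f => GrowthSpace.norm_le_of_growthWeight_le (growthWeight_cesaro_le hγ f)

theorem cesaroGrowth_apply (γ : ℝ) (hγ : 0 < γ) (f : GrowthSpace γ) (z : 𝔻) :
    cesaroGrowth γ hγ f z = cesaro f z := rfl

theorem cesaroGrowth_mem_zero {γ : ℝ} (hγ : 0 < γ) {f : GrowthSpace γ}
    (hf : f ∈ GrowthSpaceZero γ) : cesaroGrowth γ hγ f ∈ GrowthSpaceZero γ := by
  change VanishingGrowth γ (cesaro f)
  have hf' : VanishingGrowth γ f := hf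
  rw [vanishingGrowth_iff] at hf' ⊢
  intro ε hε
  set K : ℝ := 2 ^ (γ + 1) + 2 / γ with hK
  set L : ℝ := 2 ^ (γ / 2 + 1) + 2 / (γ / 2) with hL
  have hKp : 0 < K := by positivity
  have hLp : 0 < L := by positivity
  obtain ⟨r, hr, H⟩ := hf' (ε / (2 * K)) (by positivity)
  set B : ℝ := ‖f‖ * (1 - r) ^ (-γ) with hB
  have hBn : 0 ≤ B := mul_nonneg (norm_nonneg _) (Real.rpow_nonneg (by linarith) _)
  have hbound : ∀ z : 𝔻, ‖f z‖ ≤ ε / (2 * K) * (1 - ‖(z : ℂ)‖) ^ (-γ) +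
      B * (1 - ‖(z : ℂ)‖) ^ (-(γ / 2)) := by
    intro z
    have hz := one_sub_norm_pos z
    have hz1 : 0 ≤ (1 - ‖(z : ℂ)‖) ^ (-γ) := Real.rpow_nonneg hz.le _
    have hz2 : 1 ≤ (1 - ‖(z : ℂ)‖) ^ (-(γ / 2)) :=
      Real.one_le_rpow_of_pos_of_le_one_of_nonpos hz (by linarith [norm_nonneg (z : ℂ)])
        (by linarith)
    rcases lt_or_ge r ‖(z : ℂ)‖ with h | h
    · have h1 := H z h
      have h2 : ‖f z‖ ≤ ε / (2 * K) * (1 - ‖(z : ℂ)‖) ^ (-γ) := by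
        rw [Real.rpow_neg hz.le, ← div_eq_mul_inv,
          le_div_iff₀ (Real.rpow_pos_of_pos hz γ), mul_comm]
        exact h1
      have h3 : 0 ≤ B * (1 - ‖(z : ℂ)‖) ^ (-(γ / 2)) := by positivity
      linarith
    · have h1 := f.norm_apply_le z
      have h2 : (1 - ‖(z : ℂ)‖) ^ (-γ) ≤ (1 - r) ^ (-γ) :=
        Real.rpow_le_rpow_of_nonpos (by linarith) (by linarith) (by linarith)
      have h3 : ‖f z‖ ≤ B := h1.trans (mul_le_mul_of_nonneg_left h2 (norm_nonneg _))
      have h4 : B ≤ B * (1 - ‖(z : ℂ)‖) ^ (-(γ / 2)) := le_mul_of_one_le_right hBn hz2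
      have h5 : 0 ≤ ε / (2 * K) * (1 - ‖(z : ℂ)‖) ^ (-γ) := by positivity
      linarith
  have hlim : Tendsto (fun x : ℝ => B * L * (1 - x) ^ (γ / 2)) (𝓝[<] 1) (𝓝 0) := by
    have hc : Continuous fun x : ℝ => B * L * (1 - x) ^ (γ / 2) :=
      continuous_const.mul ((continuous_const.sub continuous_id).rpow_const
        fun _ => Or.inr (by positivity))
    have := hc.tendsto 1
    rw [sub_self, Real.zero_rpow (by positivity), mul_zero] at this
    exact this.mono_left nhdsWithin_le_nhds
  obtain ⟨r', hr', H'⟩ := (nhdsLT_basis (1 : ℝ)).eventually_iff.1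
    (hlim.eventually_lt_const (half_pos hε))
  refine ⟨r', hr', fun z hz => ?_⟩
  have h1 := norm_cesaro_le hγ (half_pos hγ) (by positivity) hBn hbound z
  have h2 := H' ⟨hz, z.norm_lt_one⟩
  have hz := one_sub_norm_pos z
  have hp := Real.rpow_pos_of_pos hz γ
  have e1 : (1 - ‖(z : ℂ)‖) ^ γ * (1 - ‖(z : ℂ)‖) ^ (-γ) = 1 := by
    rw [← Real.rpow_add hz]; simp
  have e2 : (1 - ‖(z : ℂ)‖) ^ γ * (1 - ‖(z : ℂ)‖) ^ (-(γ / 2)) =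
      (1 - ‖(z : ℂ)‖) ^ (γ / 2) := by
    rw [← Real.rpow_add hz]; congr 1; ring
  have e3 : ε / (2 * K) * K = ε / 2 := by field_simp
  calc growthWeight γ (cesaro f) z
      ≤ (1 - ‖(z : ℂ)‖) ^ γ * (ε / (2 * K) * (K * (1 - ‖(z : ℂ)‖) ^ (-γ)) +
          B * (L * (1 - ‖(z : ℂ)‖) ^ (-(γ / 2)))) := mul_le_mul_of_nonneg_left h1 hp.le
    _ = ε / (2 * K) * K * ((1 - ‖(z : ℂ)‖) ^ γ * (1 - ‖(z : ℂ)‖) ^ (-γ)) +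
          B * L * ((1 - ‖(z : ℂ)‖) ^ γ * (1 - ‖(z : ℂ)‖) ^ (-(γ / 2))) := by ring
    _ = ε / 2 + B * L * (1 - ‖(z : ℂ)‖) ^ (γ / 2) := by rw [e1, e2, e3, mul_one]
    _ ≤ ε := by linarith

/-- The Cesàro operator `C_{γ,0} : A_0^{-γ} → A_0^{-γ}`, the restriction of `C_γ`. -/
noncomputable def cesaroGrowthZero (γ : ℝ) (hγ : 0 < γ) :
    GrowthSpaceZero γ →L[ℂ] GrowthSpaceZero γ :=
  ((cesaroGrowth γ hγ).comp (GrowthSpaceZero γ).subtypeL).codRestrict (GrowthSpaceZero γ)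
    fun f => cesaroGrowth_mem_zero hγ f.2

/-! ### Ergodic notions for bounded operators -/

section Ergodic

variable {X : Type*} [NormedAddCommGroup X] [NormedSpace ℂ X]

/-- The Cesàro averages `T_[n] = (1/n) ∑_{m=1}^n T^m`, for `n ≥ 1`. -/
noncomputable def ergodicMean (T : X →L[ℂ] X) (n : ℕ) : X →L[ℂ] X :=
  (n : ℂ)⁻¹ • ∑ m ∈ Finset.Icc 1 n, T ^ m

/-- `T` is power bounded: `sup_n ‖T^n‖ < ∞`. -/
def IsPowerBounded (T : X →L[ℂ] X) : Prop :=
  BddAbove (Set.range fun n : ℕ => ‖T ^ n‖)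

/-- `T` is mean ergodic: its Cesàro averages converge to a bounded operator in the strong
operator topology. -/
def IsMeanErgodic (T : X →L[ℂ] X) : Prop :=
  ∃ P : X →L[ℂ] X, ∀ x : X, Tendsto (fun n => ergodicMean T n x) atTop (𝓝 (P x))

/-- `T` is uniformly mean ergodic: its Cesàro averages converge in the operator norm. -/
def IsUniformlyMeanErgodic (T : X →L[ℂ] X) : Prop :=
  ∃ P : X →L[ℂ] X, Tendsto (fun n => ‖ergodicMean T n - P‖) atTop (𝓝 0)

/-- The kernel of `I - T`. -/
def kerIdSub (T : X →L[ℂ] X) : Submodule ℂ X :=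
  LinearMap.ker (ContinuousLinearMap.id ℂ X - T).toLinearMap

/-- The range `Im (I - T)`. -/
def imIdSub (T : X →L[ℂ] X) : Submodule ℂ X :=
  LinearMap.range (ContinuousLinearMap.id ℂ X - T).toLinearMap

/-- A proper closed subspace. -/
def IsProperClosed (Y : Submodule ℂ X) : Prop :=
  IsClosed (Y : Set X) ∧ Y ≠ ⊤

end Ergodic

/-! ### Ergodic theory of bounded operators -/

section AbstractErgodic

variable {X : Type*} [NormedAddCommGroup X] [NormedSpace ℂ X]

/-! Everything rests on one identity: with `v = (1 - z) C f`, one has `z v' = f - C f`. Hence the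
fixed points of `C` are the multiples of `φ = 1 / (1 - z)`, the equation `f - C f = h` is solved by
one integration when `h(0) = 0`, and a bound on `f - C f` controls `v'`, hence `v`, hence `f`.

The direction of integration depends on `γ`. For `γ > 1` one integrates from the origin, where `v`
vanishes if `f(0) = 0`; so `I - C` is bounded below on `{f(0) = 0}`. For `γ < 1` the weight is
integrable up to the boundary and one integrates along the segment from `z` to `1`, where `v` tends
to `0`; so `I - C` is bounded below on the whole space. Thus the kernel is trivial for `γ < 1`, and
the range is closed in both cases. For `γ ≥ 1` a sharp integral estimate gives `‖C‖ ≤ 1`.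

The negative results for `γ ≤ 1` share one obstruction. `C` preserves the value at `0`, so `Im (I -
C)` consists of functions vanishing there, while no nonzero fixed point lies in `A_0^{-γ}`. If the
averages of the constant `1` converged, the limit would be a fixed point in the closed space
`A_0^{-γ}` with value `1` at `0`. Likewise a power bounded operator with closed `Im (I - T)` splits
each vector into a fixed point and an element of the range (`IsPowerBounded.exists_fixed_sub_mem`),
which is impossible for the constant `1`. So power boundedness and closed range exclude each other:
for `γ < 1` the former fails, for `γ = 1` the latter.

For `γ > 1`, `f - f(0) φ` equals `g - C g` with `‖g‖ ≤ K ‖f‖`; the averages fix `φ` and telescope on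
`g - C g`, which gives convergence at rate `1 / n` in operator norm. -/

theorem mem_imIdSub {T : X →L[ℂ] X} {y : X} : y ∈ imIdSub T ↔ ∃ x, x - T x = y := Iff.rfl

theorem mem_kerIdSub {T : X →L[ℂ] X} {x : X} : x ∈ kerIdSub T ↔ T x = x := by
  change x - T x = 0 ↔ _
  rw [sub_eq_zero, eq_comm]

theorem ergodicMean_apply (T : X →L[ℂ] X) (n : ℕ) (x : X) :
    ergodicMean T n x = (n : ℂ)⁻¹ • ∑ m ∈ Finset.Icc 1 n, (T ^ m) x := by
  simp [ergodicMean]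

/-- The sum telescopes. At `n = 0` both sides vanish because `0⁻¹ = 0`; this convention is why later
statements need `n ≠ 0`. -/
theorem ergodicMean_sub_apply (T : X →L[ℂ] X) (n : ℕ) (x : X) :
    ergodicMean T n (x - T x) = (n : ℂ)⁻¹ • (T x - (T ^ (n + 1)) x) := by
  rw [ergodicMean_apply]
  congr 1
  induction n with
  | zero => simp
  | succ n ih =>
    rw [Finset.sum_Icc_succ_top (by omega), ih, map_sub, pow_succ T (n + 1)]
    simp

theorem ergodicMean_apply_of_fixed {T : X →L[ℂ] X} {x : X} (hx : T x = x) {n : ℕ} (hn : n ≠ 0) :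
    ergodicMean T n x = x := by
  have h : ∀ m, (T ^ m) x = x := fun m => by
    induction m with
    | zero => simp
    | succ m ih => rw [pow_succ, mul_apply_eq_comp, hx, ih]
  have hn' : (n : ℂ) ≠ 0 := Nat.cast_ne_zero.2 hn
  rw [ergodicMean_apply, Finset.sum_congr rfl fun m _ => h m, Finset.sum_const, Nat.card_Icc,
    Nat.add_sub_cancel, ← Nat.cast_smul_eq_nsmul ℂ, smul_smul, inv_mul_cancel₀ hn', one_smul]

theorem sub_pow_apply_mem_imIdSub (T : X →L[ℂ] X) (m : ℕ) (x : X) :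
    x - (T ^ m) x ∈ imIdSub T := by
  induction m with
  | zero => simp
  | succ m ih =>
    have h : x - (T ^ (m + 1)) x = (x - (T ^ m) x) + ((T ^ m) x - T ((T ^ m) x)) := by
      rw [pow_succ' T m, mul_apply_eq_comp]
      abel
    rw [h]
    exact add_mem ih (mem_imIdSub.2 ⟨_, rfl⟩)

/-- The difference is the average of the vectors `x - T^m x`, each of which is divisible by `I - T`.
For the Cesàro operator this says that averaging keeps the value at the origin. -/
theorem sub_ergodicMean_mem_imIdSub (T : X →L[ℂ] X) {n : ℕ} (hn : n ≠ 0) (x : X) :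
    x - ergodicMean T n x ∈ imIdSub T := by
  have hn' : (n : ℂ) ≠ 0 := Nat.cast_ne_zero.2 hn
  have h : x - ergodicMean T n x = (n : ℂ)⁻¹ • ∑ m ∈ Finset.Icc 1 n, (x - (T ^ m) x) := by
    rw [Finset.sum_sub_distrib, smul_sub, ← ergodicMean_apply, Finset.sum_const, Nat.card_Icc,
      Nat.add_sub_cancel, ← Nat.cast_smul_eq_nsmul ℂ, smul_smul, inv_mul_cancel₀ hn', one_smul]
  rw [h]
  exact Submodule.smul_mem _ _ (Submodule.sum_mem _ fun m _ => sub_pow_apply_mem_imIdSub T m x)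

theorem ergodicMean_mem_of_invariant {T : X →L[ℂ] X} {Z : Submodule ℂ X}
    (hTZ : ∀ z ∈ Z, T z ∈ Z) {x : X} (hx : x ∈ Z) (n : ℕ) : ergodicMean T n x ∈ Z := by
  rw [ergodicMean_apply]
  refine Submodule.smul_mem _ _ (Submodule.sum_mem _ fun m hm => ?_)
  clear hm
  induction m with
  | zero => simpa
  | succ m ih =>
    rw [pow_succ', mul_apply_eq_comp]
    exact hTZ _ ih

theorem commute_ergodicMean (T : X →L[ℂ] X) (n : ℕ) : Commute T (ergodicMean T n) :=
  Commute.smul_right (Commute.sum_right _ _ _ fun m _ => Commute.self_pow T m) _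

theorem norm_ergodicMean_sub_le {T : X →L[ℂ] X} {M : ℝ} (hM : ∀ n : ℕ, ‖T ^ n‖ ≤ M) (n : ℕ)
    (x : X) : ‖ergodicMean T n (x - T x)‖ ≤ 2 * M * ‖x‖ / n := by
  have h1 : ‖T x‖ ≤ M * ‖x‖ := by simpa using (T ^ 1).le_of_opNorm_le (hM 1) x
  have h2 := (T ^ (n + 1)).le_of_opNorm_le (hM (n + 1)) x
  rw [ergodicMean_sub_apply, norm_smul, norm_inv, Complex.norm_natCast, div_eq_inv_mul]
  refine mul_le_mul_of_nonneg_left ?_ (by positivity)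
  linarith [norm_sub_le (T x) ((T ^ (n + 1)) x)]

/-- A limit of the Cesàro averages of an orbit is a fixed point. -/
theorem apply_eq_self_of_tendsto_ergodicMean {T : X →L[ℂ] X} {x p : X}
    (h : Tendsto (fun n => ergodicMean T n x) atTop (𝓝 p)) : T p = p := by
  have h1 : Tendsto (fun n => T (ergodicMean T n x)) atTop (𝓝 (T p)) :=
    (T.continuous.tendsto p).comp h
  have h' := h.comp (tendsto_add_atTop_nat 1)
  have hinv : Tendsto (fun n : ℕ => (n : ℂ)⁻¹) atTop (𝓝 0) := tendsto_inv_atTop_nhds_zero_nat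
  -- From `(n + 1) T_[n+1] x = T x + n T T_[n] x`, this expression equals `T T_[n] x` for `n ≠ 0`.
  -- Comparing limits needs no power boundedness.
  have h2 : Tendsto (fun n : ℕ => ergodicMean T (n + 1) x +
      (n : ℂ)⁻¹ • (ergodicMean T (n + 1) x - T x)) atTop (𝓝 (p + (0 : ℂ) • (p - T x))) :=
    h'.add (hinv.smul (h'.sub_const _))
  rw [zero_smul, add_zero] at h2
  refine tendsto_nhds_unique h1 (h2.congr' ?_)
  filter_upwards [eventually_ne_atTop 0] with n hn
  have hn' : (n : ℂ) ≠ 0 := Nat.cast_ne_zero.2 hn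
  have hn1 : ((n : ℂ) + 1) ≠ 0 := by exact_mod_cast n.succ_ne_zero
  have hsum : ∑ m ∈ Finset.Icc 1 (n + 1), (T ^ m) x =
      T x + T (∑ m ∈ Finset.Icc 1 n, (T ^ m) x) := by
    clear hn hn' hn1
    induction n with
    | zero => simp
    | succ n ih =>
      rw [Finset.sum_Icc_succ_top (b := n + 1) (by omega)]
      nth_rewrite 1 [ih]
      rw [Finset.sum_Icc_succ_top (b := n) (by omega), map_add,
        pow_succ' T (n + 1), mul_apply_eq_comp, add_assoc]
  have hA : ((n : ℂ) + 1) • ergodicMean T (n + 1) x = T x + (n : ℂ) • T (ergodicMean T n x) := by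
    rw [ergodicMean_apply, ergodicMean_apply, hsum, map_smul, smul_smul, smul_smul]
    push_cast
    rw [mul_inv_cancel₀ hn1, mul_inv_cancel₀ hn', one_smul, one_smul]
  have hB : (n : ℂ) • (ergodicMean T (n + 1) x + (n : ℂ)⁻¹ • (ergodicMean T (n + 1) x - T x)) =
      (n : ℂ) • T (ergodicMean T n x) := by
    rw [smul_add, smul_smul, mul_inv_cancel₀ hn', one_smul]
    rw [add_smul, one_smul] at hA
    rw [← sub_eq_iff_eq_add'.2 hA]
    abel
  exact smul_right_injective X hn' hB

/-- If `T` is power bounded and `Im (I - T)` is closed, then every vector is the sum of a fixed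
point and an element of `Im (I - T)`. The fixed point can be found in any closed invariant subspace
that contains the vector. -/
theorem IsPowerBounded.exists_fixed_sub_mem [CompleteSpace X] {T : X →L[ℂ] X}
    (hT : IsPowerBounded T) (hcl : IsClosed (imIdSub T : Set X)) {Z : Submodule ℂ X}
    (hZ : IsClosed (Z : Set X)) (hTZ : ∀ z ∈ Z, T z ∈ Z) {x : X} (hx : x ∈ Z) :
    ∃ k ∈ Z, T k = k ∧ x - k ∈ imIdSub T := by
  obtain ⟨M, hM⟩ := hT
  replace hM : ∀ n : ℕ, ‖T ^ n‖ ≤ M := fun n => hM ⟨n, rfl⟩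
  have hM0 : 0 ≤ M := (norm_nonneg _).trans (hM 0)
  have : CompleteSpace (imIdSub T) := hcl.completeSpace_coe
  -- The open mapping theorem, available because the closed range is a Banach space.
  obtain ⟨K, hK, hpre⟩ : ∃ K > 0, ∀ y ∈ imIdSub T, ∃ x, x - T x = y ∧ ‖x‖ ≤ K * ‖y‖ := by
    let R : X →L[ℂ] imIdSub T := (ContinuousLinearMap.id ℂ X - T).codRestrict (imIdSub T)
      fun x => mem_imIdSub.2 ⟨x, rfl⟩
    have hR : Function.Surjective R := by
      rintro ⟨y, hy⟩
      obtain ⟨x, hx⟩ := mem_imIdSub.1 hy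
      exact ⟨x, Subtype.ext hx⟩
    obtain ⟨K, hK, H⟩ := R.exists_preimage_norm_le hR
    refine ⟨K, hK, fun y hy => ?_⟩
    obtain ⟨x, hx, hxn⟩ := H ⟨y, hy⟩
    exact ⟨x, congrArg Subtype.val hx, hxn⟩
  -- On `y = g - T g` the average has norm at most `2 M ‖g‖ / n ≤ (2 M K / n) ‖y‖`, so this `n`
  -- makes it a contraction by `1 / 2` on the range. The fixed point is then the limit of the
  -- iterates `S^j x`.
  obtain ⟨n, hn⟩ := exists_nat_gt (4 * M * K)
  have hn0 : (0 : ℝ) < n := lt_of_le_of_lt (by positivity) hn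
  have hnne : n ≠ 0 := by
    rintro rfl
    simp at hn0
  set S := ergodicMean T n with hS
  have hSY : ∀ y ∈ imIdSub T, S y ∈ imIdSub T := fun y hy => by
    have := sub_mem hy (sub_ergodicMean_mem_imIdSub T hnne y)
    rwa [sub_sub_cancel] at this
  have hhalf : ∀ y ∈ imIdSub T, ‖S y‖ ≤ 1 / 2 * ‖y‖ := by
    intro y hy
    obtain ⟨g, rfl, hgn⟩ := hpre y hy
    refine (norm_ergodicMean_sub_le hM n g).trans ?_
    rw [div_le_iff₀ hn0]
    have h1 : 2 * M * ‖g‖ ≤ 2 * M * (K * ‖g - T g‖) :=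
      mul_le_mul_of_nonneg_left hgn (by positivity)
    nlinarith [norm_nonneg (g - T g)]
  have hpow : ∀ y ∈ imIdSub T, ∀ j : ℕ, (S ^ j) y ∈ imIdSub T ∧
      ‖(S ^ j) y‖ ≤ ‖y‖ * (1 / 2) ^ j := by
    intro y hy j
    induction j with
    | zero => simpa using hy
    | succ j ih =>
      rw [pow_succ' S, mul_apply_eq_comp]
      refine ⟨hSY _ ih.1, (hhalf _ ih.1).trans ?_⟩
      rw [pow_succ]
      linarith [ih.2]
  have hdist : ∀ j : ℕ, dist ((S ^ j) x) ((S ^ (j + 1)) x) ≤ ‖x - S x‖ * (1 / 2) ^ j := by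
    intro j
    rw [dist_eq_norm, pow_succ S, mul_apply_eq_comp, ← map_sub]
    exact (hpow _ (sub_ergodicMean_mem_imIdSub T hnne x) j).2
  obtain ⟨k, hk⟩ := cauchySeq_tendsto_of_complete
    (cauchySeq_of_le_geometric _ _ (by norm_num) hdist)
  have hSZ : ∀ j, (S ^ j) x ∈ Z := fun j => by
    induction j with
    | zero => simpa
    | succ j ih =>
      rw [pow_succ', mul_apply_eq_comp]
      exact ergodicMean_mem_of_invariant hTZ ih n
  have hSx : ∀ j, x - (S ^ j) x ∈ imIdSub T := fun j => by
    induction j with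
    | zero => simp
    | succ j ih =>
      have := add_mem ih (sub_ergodicMean_mem_imIdSub T hnne ((S ^ j) x))
      rwa [sub_add_sub_cancel, ← hS, ← mul_apply_eq_comp, ← pow_succ'] at this
  refine ⟨k, hZ.mem_of_tendsto hk (Eventually.of_forall hSZ), ?_,
    hcl.mem_of_tendsto (tendsto_const_nhds.sub hk) (Eventually.of_forall hSx)⟩
  have h1 : Tendsto (fun j => (S ^ j) x - T ((S ^ j) x)) atTop (𝓝 (k - T k)) :=
    hk.sub ((T.continuous.tendsto k).comp hk)
  -- `T` commutes with `S`, so the defect is `S^j (x - T x)`, the orbit of a range element under the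
  -- contraction.
  have h2 : Tendsto (fun j => (S ^ j) x - T ((S ^ j) x)) atTop (𝓝 0) := by
    refine squeeze_zero_norm (a := fun j : ℕ => ‖x - T x‖ * (1 / 2) ^ j) (fun j => ?_) ?_
    · have hc : T ((S ^ j) x) = (S ^ j) (T x) :=
        DFunLike.congr_fun ((commute_ergodicMean T n).pow_right j) x
      rw [hc, ← map_sub]
      exact (hpow _ (mem_imIdSub.2 ⟨x, rfl⟩) j).2
    · simpa using (tendsto_pow_atTop_nhds_zero_of_lt_one (r := (1 / 2 : ℝ)) (by norm_num)
        (by norm_num)).const_mul ‖x - T x‖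
  exact (sub_eq_zero.1 (tendsto_nhds_unique h1 h2)).symm

/-- If `I - T` is bounded below on a closed subspace `Y` with `(I - T) Y = Im (I - T)`, then
`Im (I - T)` is closed. -/
theorem isClosed_imIdSub [CompleteSpace X] {T : X →L[ℂ] X} {Y : Submodule ℂ X}
    (hY : IsClosed (Y : Set X)) {K : ℝ} (hK : ∀ y ∈ Y, ‖y‖ ≤ K * ‖y - T y‖)
    (hYT : ∀ x, ∃ y ∈ Y, y - T y = x - T x) : IsClosed (imIdSub T : Set X) := by
  have : CompleteSpace Y := hY.completeSpace_coe
  let R : Y →L[ℂ] X := (ContinuousLinearMap.id ℂ X - T).comp Y.subtypeL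
  have hR : AntilipschitzWith K.toNNReal R := by
    refine AddMonoidHomClass.antilipschitz_of_bound R fun y => (hK y y.2).trans ?_
    exact mul_le_mul_of_nonneg_right (Real.le_coe_toNNReal K) (norm_nonneg _)
  have hrange : (imIdSub T : Set X) = Set.range R := by
    ext x
    constructor
    · rintro ⟨y, rfl⟩
      obtain ⟨y', hy', h⟩ := hYT y
      exact ⟨⟨y', hy'⟩, h⟩
    · rintro ⟨y, rfl⟩
      exact ⟨y, rfl⟩
  rw [hrange]
  exact hR.isClosed_range R.uniformContinuous

theorem isPowerBounded_of_norm_le_one {T : X →L[ℂ] X} (hT : ‖T‖ ≤ 1) : IsPowerBounded T := by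
  refine ⟨1, ?_⟩
  rintro _ ⟨n, rfl⟩
  change ‖T ^ n‖ ≤ 1
  induction n with
  | zero => simpa [ContinuousLinearMap.one_def] using ContinuousLinearMap.norm_id_le
  | succ n ih =>
    rw [pow_succ]
    exact (norm_mul_le _ _).trans (mul_le_one₀ ih (norm_nonneg _) hT)

end AbstractErgodic

/-! ### Growth estimates for holomorphic functions on the disc -/

/-- Dividing by `z` costs a factor `2` where `|z| ≥ 1/2`. Nearer the origin the maximum principle
carries over the bound from the circle `|z| = 1/2`, where the weight equals `2^γ`. -/
theorem norm_le_of_norm_mul_le {γ A : ℝ} (hγ : 0 ≤ γ) {g : ℂ → ℂ}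
    (hg : DifferentiableOn ℂ g (Metric.ball 0 1))
    (h : ∀ z ∈ Metric.ball (0 : ℂ) 1, ‖z * g z‖ ≤ A * (1 - ‖z‖) ^ (-γ)) {z : ℂ}
    (hz : z ∈ Metric.ball (0 : ℂ) 1) : ‖g z‖ ≤ 2 * 2 ^ γ * A * (1 - ‖z‖) ^ (-γ) := by
  have hA : 0 ≤ A := by simpa using h 0 (by simp)
  have hz1 : ‖z‖ < 1 := by simpa using hz
  have h2 : (1 : ℝ) ≤ 2 ^ γ := Real.one_le_rpow one_le_two hγ
  have h1 : 1 ≤ (1 - ‖z‖) ^ (-γ) :=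
    Real.one_le_rpow_of_pos_of_le_one_of_nonpos (by linarith) (by linarith [norm_nonneg z])
      (by linarith)
  rcases le_or_gt (1 / 2) ‖z‖ with hz2 | hz2
  · have h3 := h z hz
    rw [norm_mul] at h3
    have h4 : A * (1 - ‖z‖) ^ (-γ) ≤ 2 ^ γ * (A * (1 - ‖z‖) ^ (-γ)) :=
      le_mul_of_one_le_left (by positivity) h2
    nlinarith [norm_nonneg (g z)]
  · have hsub : Metric.closedBall (0 : ℂ) (1 / 2) ⊆ Metric.ball 0 1 :=
      Metric.closedBall_subset_ball (by norm_num)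
    have hd : DiffContOnCl ℂ g (Metric.ball 0 (1 / 2)) := by
      refine DifferentiableOn.diffContOnCl (hg.mono ?_)
      rwa [closure_ball _ (by norm_num)]
    have h3 : ‖g z‖ ≤ 2 * 2 ^ γ * A := by
      refine Complex.norm_le_of_forall_mem_frontier_norm_le Metric.isBounded_ball hd ?_
        (subset_closure (by simpa using hz2))
      intro w hw
      rw [frontier_ball _ (by norm_num)] at hw
      have hw1 : ‖w‖ = 1 / 2 := by simpa using hw
      have h4 := h w (hsub (Metric.sphere_subset_closedBall hw))
      rw [norm_mul, hw1] at h4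
      have h5 : (1 - 1 / 2 : ℝ) ^ (-γ) = 2 ^ γ := by
        rw [Real.rpow_neg (by norm_num), ← Real.inv_rpow (by norm_num)]
        norm_num
      rw [h5] at h4
      linarith
    exact h3.trans (le_mul_of_one_le_right (by positivity) h1)

/-- Along the radius to `z`, `u` is dominated by the primitive `A / (γ - 1) * (1 - t |z|)^(1 - γ)`
of the bound for its derivative. This primitive is nonnegative at `t = 0`, where `u` vanishes. -/
theorem norm_primitive_le_of_one_lt {γ A : ℝ} (hγ : 1 < γ) {u g : ℂ → ℂ}
    (hu : ∀ z ∈ Metric.ball (0 : ℂ) 1, HasDerivAt u (g z) z) (hu0 : u 0 = 0)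
    (hg : ∀ z ∈ Metric.ball (0 : ℂ) 1, ‖g z‖ ≤ A * (1 - ‖z‖) ^ (-γ)) {z : ℂ}
    (hz : z ∈ Metric.ball (0 : ℂ) 1) : ‖u z‖ ≤ A / (γ - 1) * (1 - ‖z‖) ^ (1 - γ) := by
  have hA : 0 ≤ A := by simpa using (norm_nonneg _).trans (hg 0 (by simp))
  have hz1 : ‖z‖ < 1 := by simpa using hz
  have hγ' : 0 < γ - 1 := by linarith
  have hder : ∀ t ∈ Set.Icc (0 : ℝ) 1, HasDerivAt (fun t : ℝ => u (t * z)) (g (t * z) * z) t := by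
    intro t ht
    have h2 : HasDerivAt (fun t : ℝ => (t : ℂ) * z) z t := by
      simpa using (Complex.ofRealCLM.hasDerivAt (x := t)).mul_const z
    exact (hu _ (ofReal_mul_mem_ball hz1 ht)).comp t h2
  have hB : ∀ t ∈ Set.Icc (0 : ℝ) 1, HasDerivAt (fun t : ℝ => A / (γ - 1) * (1 - t * ‖z‖) ^ (1 - γ))
      (A * (1 - t * ‖z‖) ^ (-γ) * ‖z‖) t := by
    intro t ht
    have h3 : HasDerivAt (fun t : ℝ => 1 - t * ‖z‖) (-‖z‖) t := by
      simpa using ((hasDerivAt_id t).mul_const ‖z‖).const_sub 1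
    refine ((h3.rpow_const (p := 1 - γ) (Or.inl
      (one_sub_mul_pos (norm_nonneg z) hz1 ht).ne')).const_mul (A / (γ - 1))).congr_deriv ?_
    rw [show 1 - γ - 1 = -γ by ring]
    field_simp
    ring
  have := image_norm_le_of_norm_deriv_right_le_deriv_boundary'
    (f := fun t : ℝ => u (t * z)) (f' := fun t : ℝ => g (t * z) * z) (a := 0) (b := 1)
    (B := fun t : ℝ => A / (γ - 1) * (1 - t * ‖z‖) ^ (1 - γ))
    (B' := fun t : ℝ => A * (1 - t * ‖z‖) ^ (-γ) * ‖z‖)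
    (fun t ht => (hder t ht).continuousAt.continuousWithinAt)
    (fun t ht => (hder t (Set.Ico_subset_Icc_self ht)).hasDerivWithinAt)
    (by simp [hu0]; positivity)
    (fun t ht => (hB t ht).continuousAt.continuousWithinAt)
    (fun t ht => (hB t (Set.Ico_subset_Icc_self ht)).hasDerivWithinAt) ?_
    (Set.right_mem_Icc.2 zero_le_one)
  · simpa using this
  · intro t ht
    have h4 := hg _ (ofReal_mul_mem_ball hz1 (Set.Ico_subset_Icc_self ht))
    rw [norm_mul (t : ℂ) z, Complex.norm_real, Real.norm_of_nonneg ht.1] at h4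
    rw [norm_mul]
    exact mul_le_mul_of_nonneg_right h4 (norm_nonneg z)

/-- Integration along the segment from `z` to `1`, on which `1 - |w| ≥ (1 - s)(1 - |z|)` and `(1 -
s)^(-γ)` is integrable. The a priori constant `B` serves only to make `v` tend to `0` at `1`, so it
drops out of the conclusion. -/
theorem norm_primitive_le_of_lt_one {γ A B : ℝ} (hγ0 : 0 < γ) (hγ : γ < 1) {v g : ℂ → ℂ}
    (hv : ∀ z ∈ Metric.ball (0 : ℂ) 1, HasDerivAt v (g z) z)
    (hvB : ∀ z ∈ Metric.ball (0 : ℂ) 1, ‖v z‖ ≤ B * ‖1 - z‖ * (1 - ‖z‖) ^ (-γ))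
    (hg : ∀ z ∈ Metric.ball (0 : ℂ) 1, ‖g z‖ ≤ A * (1 - ‖z‖) ^ (-γ)) {z : ℂ}
    (hz : z ∈ Metric.ball (0 : ℂ) 1) :
    ‖v z‖ ≤ A / (1 - γ) * ‖1 - z‖ * (1 - ‖z‖) ^ (-γ) := by
  have hA : 0 ≤ A := by simpa using (norm_nonneg _).trans (hg 0 (by simp))
  have hBn : 0 ≤ B := by simpa using (norm_nonneg _).trans (hvB 0 (by simp))
  have hz1 : ‖z‖ < 1 := by simpa using hz
  have hzp : 0 < 1 - ‖z‖ := by linarith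
  have hγ' : 0 < 1 - γ := by linarith
  set D : ℝ := A * ‖1 - z‖ * (1 - ‖z‖) ^ (-γ) with hD
  have hDn : 0 ≤ D := by positivity
  -- the segment from `z` to `1`
  have hnorm : ∀ s ∈ Set.Ico (0 : ℝ) 1, (1 - s) * (1 - ‖z‖) ≤ 1 - ‖z + s * (1 - z)‖ := by
    intro s hs
    have h1 : z + s * (1 - z) = ((1 - s : ℝ) : ℂ) * z + (s : ℂ) := by push_cast; ring
    have h2 := norm_add_le (((1 - s : ℝ) : ℂ) * z) (s : ℂ)
    rw [norm_mul, Complex.norm_real, Complex.norm_real, Real.norm_of_nonneg hs.1,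
      Real.norm_of_nonneg (by linarith [hs.2])] at h2
    rw [h1]
    linarith
  have hpos : ∀ s ∈ Set.Ico (0 : ℝ) 1, 0 < (1 - s) * (1 - ‖z‖) := fun s hs =>
    mul_pos (by linarith [hs.2]) hzp
  have hmem : ∀ s ∈ Set.Ico (0 : ℝ) 1, z + s * (1 - z) ∈ Metric.ball (0 : ℂ) 1 := by
    intro s hs
    rw [mem_ball_zero_iff]
    linarith [hnorm s hs, hpos s hs]
  have hweight : ∀ s ∈ Set.Ico (0 : ℝ) 1, (1 - ‖z + s * (1 - z)‖) ^ (-γ) ≤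
      (1 - s) ^ (-γ) * (1 - ‖z‖) ^ (-γ) := by
    intro s hs
    rw [← Real.mul_rpow (by linarith [hs.2]) hzp.le]
    exact Real.rpow_le_rpow_of_nonpos (hpos s hs) (hnorm s hs) (by linarith)
  have hder : ∀ s ∈ Set.Ico (0 : ℝ) 1, HasDerivAt (fun s : ℝ => v (z + s * (1 - z)) - v z)
      (g (z + s * (1 - z)) * (1 - z)) s := by
    intro s hs
    have h2 : HasDerivAt (fun s : ℝ => z + (s : ℂ) * (1 - z)) (1 - z) s := by
      simpa using ((Complex.ofRealCLM.hasDerivAt (x := s)).mul_const (1 - z)).const_add z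
    exact ((hv _ (hmem s hs)).comp s h2).sub_const _
  have hbdry : ∀ s ∈ Set.Ico (0 : ℝ) 1, HasDerivAt
      (fun s : ℝ => D / (1 - γ) * (1 - (1 - s) ^ (1 - γ))) (D * (1 - s) ^ (-γ)) s := by
    intro s hs
    have h3 : HasDerivAt (fun s : ℝ => 1 - s) (-1) s := by
      simpa using (hasDerivAt_id s).const_sub 1
    refine (((h3.rpow_const (p := 1 - γ) (Or.inl (by linarith [hs.2]))).const_sub
      1).const_mul (D / (1 - γ))).congr_deriv ?_
    rw [show 1 - γ - 1 = -γ by ring]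
    field_simp
  -- Only `s < 1` is allowed, since `v` is uncontrolled at the boundary point `1`; the bound is
  -- uniform in `s`.
  have hdiff : ∀ s ∈ Set.Ico (0 : ℝ) 1, ‖v (z + s * (1 - z)) - v z‖ ≤ D / (1 - γ) := by
    intro s hs
    have hsub : Set.Icc 0 s ⊆ Set.Ico (0 : ℝ) 1 := fun t ht => ⟨ht.1, ht.2.trans_lt hs.2⟩
    have h5 := image_norm_le_of_norm_deriv_right_le_deriv_boundary'
      (f := fun s : ℝ => v (z + s * (1 - z)) - v z)
      (f' := fun s : ℝ => g (z + s * (1 - z)) * (1 - z)) (a := 0) (b := s)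
      (B := fun s : ℝ => D / (1 - γ) * (1 - (1 - s) ^ (1 - γ)))
      (B' := fun s : ℝ => D * (1 - s) ^ (-γ))
      (fun t ht => (hder t (hsub ht)).continuousAt.continuousWithinAt)
      (fun t ht => (hder t (hsub (Set.Ico_subset_Icc_self ht))).hasDerivWithinAt)
      (by simp)
      (fun t ht => (hbdry t (hsub ht)).continuousAt.continuousWithinAt)
      (fun t ht => (hbdry t (hsub (Set.Ico_subset_Icc_self ht))).hasDerivWithinAt) ?_
      (Set.right_mem_Icc.2 hs.1)
    · refine h5.trans (mul_le_of_le_one_right (by positivity) ?_)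
      linarith [Real.rpow_nonneg (show 0 ≤ 1 - s by linarith [hs.2]) (1 - γ)]
    · intro t ht
      have ht' := hsub (Set.Ico_subset_Icc_self ht)
      rw [norm_mul]
      calc ‖g (z + t * (1 - z))‖ * ‖1 - z‖
          ≤ A * ((1 - t) ^ (-γ) * (1 - ‖z‖) ^ (-γ)) * ‖1 - z‖ :=
            mul_le_mul_of_nonneg_right ((hg _ (hmem t ht')).trans
              (mul_le_mul_of_nonneg_left (hweight t ht') hA)) (norm_nonneg _)
        _ = D * (1 - t) ^ (-γ) := by rw [hD]; ring
  have hsmall : ∀ s ∈ Set.Ico (0 : ℝ) 1, ‖v (z + s * (1 - z))‖ ≤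
      B * ‖1 - z‖ * (1 - ‖z‖) ^ (-γ) * (1 - s) ^ (1 - γ) := by
    intro s hs
    have hs1 : 0 < 1 - s := by linarith [hs.2]
    have h6 : ‖1 - (z + s * (1 - z))‖ = (1 - s) * ‖1 - z‖ := by
      rw [show 1 - (z + s * (1 - z)) = ((1 - s : ℝ) : ℂ) * (1 - z) by push_cast; ring, norm_mul,
        Complex.norm_real, Real.norm_of_nonneg hs1.le]
    have h7 : (1 - s) ^ (1 - γ) = (1 - s) * (1 - s) ^ (-γ) := by
      rw [sub_eq_add_neg 1 γ, Real.rpow_add hs1, Real.rpow_one]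
    refine (hvB _ (hmem s hs)).trans ?_
    rw [h6, h7]
    calc B * ((1 - s) * ‖1 - z‖) * (1 - ‖z + s * (1 - z)‖) ^ (-γ)
        ≤ B * ((1 - s) * ‖1 - z‖) * ((1 - s) ^ (-γ) * (1 - ‖z‖) ^ (-γ)) :=
          mul_le_mul_of_nonneg_left (hweight s hs) (by positivity)
      _ = _ := by ring
  have hlim : Tendsto (fun s : ℝ => B * ‖1 - z‖ * (1 - ‖z‖) ^ (-γ) * (1 - s) ^ (1 - γ) +
      D / (1 - γ)) (𝓝[<] 1) (𝓝 (D / (1 - γ))) := by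
    have hc : Continuous fun s : ℝ => B * ‖1 - z‖ * (1 - ‖z‖) ^ (-γ) * (1 - s) ^ (1 - γ) +
        D / (1 - γ) := (continuous_const.mul ((continuous_const.sub continuous_id).rpow_const
          fun _ => Or.inr hγ'.le)).add continuous_const
    have := hc.tendsto 1
    rw [sub_self, Real.zero_rpow hγ'.ne', mul_zero, zero_add] at this
    exact this.mono_left nhdsWithin_le_nhds
  -- Let `s → 1⁻`: the value of `v` at the moving endpoint is `O((1 - s)^(1 - γ))`.
  have hfin : ‖v z‖ ≤ D / (1 - γ) := by
    refine ge_of_tendsto hlim ?_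
    filter_upwards [Ico_mem_nhdsLT (show (0 : ℝ) < 1 by norm_num)] with s hs
    have h8 := norm_sub_norm_le (v z) (v (z + s * (1 - z)))
    rw [norm_sub_rev] at h8
    linarith [hdiff s hs, hsmall s hs]
  refine hfin.trans_eq ?_
  rw [hD]
  ring

/-! ### The Cesàro operator and primitives -/

theorem mul_cesaro_eq_sub {f : 𝔻 → ℂ} (hf : HolomorphicOnDisc f) {F : ℂ → ℂ}
    (hF : ∀ z ∈ Metric.ball (0 : ℂ) 1, HasDerivAt F (discExtend f z / (1 - z)) z) (z : 𝔻) :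
    z * cesaro f z = F z - F 0 := by
  have := intervalIntegral.integral_eq_sub_of_hasDerivAt (a := 0) (b := 1)
    (f := fun t : ℝ => F (t * z))
    (f' := fun t : ℝ => discExtend f (t * z) / (1 - t * z) * z) ?_ ?_
  · rw [intervalIntegral.integral_mul_const] at this
    rw [cesaro_eq_integral, mul_comm, this]
    simp
  · intro t ht
    rw [Set.uIcc_of_le zero_le_one] at ht
    have h2 : HasDerivAt (fun t : ℝ => (t : ℂ) * (z : ℂ)) (z : ℂ) t := by
      simpa using (Complex.ofRealCLM.hasDerivAt (x := t)).mul_const (z : ℂ)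
    exact (hF _ (ofReal_mul_mem_ball z.norm_lt_one ht)).comp t h2
  · apply ContinuousOn.intervalIntegrable
    rw [Set.uIcc_of_le zero_le_one]
    exact (continuousOn_radial hf z).mul continuousOn_const

theorem hasDerivAt_mul_cesaro {f : 𝔻 → ℂ} (hf : HolomorphicOnDisc f) {z : ℂ}
    (hz : z ∈ Metric.ball (0 : ℂ) 1) :
    HasDerivAt (fun w => w * discExtend (cesaro f) w) (discExtend f z / (1 - z)) z := by
  obtain ⟨F, hF⟩ := (differentiableOn_div_one_sub hf).isExactOn_ball
  refine ((hF z hz).sub_const (F 0)).congr_of_eventuallyEq ?_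
  filter_upwards [Metric.isOpen_ball.mem_nhds hz] with w hw
  lift w to 𝔻 using by simpa using hw
  rw [discExtend_coe, mul_cesaro_eq_sub hf hF]

theorem cesaro_apply_zero (f : 𝔻 → ℂ) : cesaro f 0 = f 0 := by
  simp [cesaro]

/-- With `v = (1 - z) C f` one has `z v' = f - C f`. -/
theorem exists_hasDerivAt_one_sub_mul_cesaro {f : 𝔻 → ℂ} (hf : HolomorphicOnDisc f) :
    ∃ v g : ℂ → ℂ, DifferentiableOn ℂ g (Metric.ball 0 1) ∧
      (∀ z ∈ Metric.ball (0 : ℂ) 1, HasDerivAt v (g z) z) ∧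
      (∀ z : 𝔻, v z = (1 - z) * cesaro f z) ∧ ∀ z : 𝔻, z * g z = f z - cesaro f z := by
  have hw : DifferentiableOn ℂ (discExtend (cesaro f)) (Metric.ball 0 1) := hf.cesaro
  have hv : DifferentiableOn ℂ (fun z => (1 - z) * discExtend (cesaro f) z) (Metric.ball 0 1) :=
    DifferentiableOn.mul (by fun_prop) hw
  refine ⟨_, _, hv.deriv Metric.isOpen_ball, fun z hz =>
    (hv.differentiableAt (Metric.isOpen_ball.mem_nhds hz)).hasDerivAt,
    fun z => by rw [discExtend_coe], fun z => ?_⟩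
  have hz : (z : ℂ) ∈ Metric.ball (0 : ℂ) 1 := by simpa using z.norm_lt_one
  have hwz := (hw.differentiableAt (Metric.isOpen_ball.mem_nhds hz)).hasDerivAt
  have h1 : HasDerivAt (fun z => (1 - z) * discExtend (cesaro f) z)
      (-1 * discExtend (cesaro f) z + (1 - z) * deriv (discExtend (cesaro f)) z) z :=
    HasDerivAt.mul (by simpa using (hasDerivAt_id (z : ℂ)).const_sub 1) hwz
  -- Two derivatives of `z C f`: the defining one and the one from the product rule.
  have h2 : discExtend f z / (1 - z) = 1 * discExtend (cesaro f) z +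
      z * deriv (discExtend (cesaro f)) z :=
    (hasDerivAt_mul_cesaro hf hz).unique ((hasDerivAt_id (z : ℂ)).mul hwz)
  rw [div_eq_iff (one_sub_ne_zero_of_mem_ball hz), discExtend_coe, discExtend_coe] at h2
  rw [h1.deriv, discExtend_coe, h2]
  ring

theorem sub_cesaro_apply_zero (f : 𝔻 → ℂ) : f 0 - cesaro f 0 = 0 := by
  rw [cesaro_apply_zero, sub_self]

/-- The fixed points of the Cesàro operator are the multiples of `1 / (1 - z)`. -/
theorem eq_of_cesaro_eq_self {f : 𝔻 → ℂ} (hf : HolomorphicOnDisc f) (h : cesaro f = f) (z : 𝔻) :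
    f z = f 0 * (1 / (1 - z)) := by
  obtain ⟨v, g, hgd, hv, hvw, hg⟩ := exists_hasDerivAt_one_sub_mul_cesaro hf
  have hg0 : ∀ z ∈ Metric.ball (0 : ℂ) 1, g z = 0 := by
    intro z hz
    -- The estimate with `γ = A = 0` turns `z g = 0` into `g = 0`, including at the origin.
    have := norm_le_of_norm_mul_le (γ := 0) (A := 0) le_rfl hgd (fun w hw => by
      lift w to 𝔻 using by simpa using hw
      simp [hg, h]) hz
    simpa using this
  have hz : (z : ℂ) ∈ Metric.ball (0 : ℂ) 1 := by simpa using z.norm_lt_one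
  have hc : v z = v 0 := Metric.isOpen_ball.is_const_of_deriv_eq_zero
    (convex_ball (0 : ℂ) 1).isPreconnected
    (fun w hw => (hv w hw).differentiableAt.differentiableWithinAt)
    (fun w hw => by rw [(hv w hw).deriv, hg0 w hw]; rfl) hz (by simp)
  have h0 := hvw 0
  rw [Complex.UnitDisc.coe_zero] at h0
  rw [hvw z, h0, h] at hc
  have hne := one_sub_ne_zero_of_mem_ball hz
  field_simp
  simpa [mul_comm] using hc

/-- The equation `f - C f = h` is solvable when `h(0) = 0`, with `f = h + u / (1 - z)`, `z u' = h`,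
`u(0) = 0`. -/
theorem exists_sub_cesaro_eq {h : 𝔻 → ℂ} (hh : HolomorphicOnDisc h) (h0 : h 0 = 0) :
    ∃ f : 𝔻 → ℂ, HolomorphicOnDisc f ∧ f 0 = 0 ∧ ∀ z, f z - cesaro f z = h z := by
  have hgd : DifferentiableOn ℂ (dslope (discExtend h) 0) (Metric.ball 0 1) :=
    (Complex.differentiableOn_dslope (Metric.ball_mem_nhds (0 : ℂ) one_pos)).2 hh
  have h0' : discExtend h 0 = 0 := by
    have := discExtend_coe h 0
    rwa [Complex.UnitDisc.coe_zero, h0] at this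
  obtain ⟨u, hu0, hu⟩ := hgd.isExactOn_ball.with_val_at 0 0
  have hud : DifferentiableOn ℂ u (Metric.ball 0 1) := fun z hz =>
    (hu z hz).differentiableAt.differentiableWithinAt
  have hzg : ∀ z : ℂ, z * dslope (discExtend h) 0 z = discExtend h z := fun z => by
    have := sub_smul_dslope (discExtend h) 0 z
    simpa [h0'] using this
  set Ff : ℂ → ℂ := fun z => discExtend h z + u z / (1 - z) with hFf
  have hFfd : DifferentiableOn ℂ Ff (Metric.ball 0 1) := DifferentiableOn.add hh
    (hud.div (by fun_prop) fun _ hw => one_sub_ne_zero_of_mem_ball hw)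
  set f : 𝔻 → ℂ := fun z => Ff z with hf
  have hfe : Set.EqOn (discExtend f) Ff (Metric.ball (0 : ℂ) 1) := discExtend_eqOn fun _ => rfl
  have hfd : HolomorphicOnDisc f := hFfd.congr hfe
  have hf0 : f 0 = 0 := by simp [hf, hFf, h0', hu0]
  refine ⟨f, hfd, hf0, fun z => ?_⟩
  rcases eq_or_ne (z : ℂ) 0 with hz0 | hz0
  · have : z = 0 := by simpa using hz0
    rw [this, cesaro_apply_zero, sub_self, h0]
  -- This primitive of `f / (1 - z)` vanishes at `0`, so it is `z C f`. Hence `C f = u / (1 - z)`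
  -- and `f - C f = h`.
  have hF : ∀ z ∈ Metric.ball (0 : ℂ) 1, HasDerivAt (fun z => z * (u z / (1 - z)))
      (discExtend f z / (1 - z)) z := by
    intro z hz
    have hne := one_sub_ne_zero_of_mem_ball hz
    have h1 : HasDerivAt (fun z : ℂ => 1 - z) (-1) z := by
      simpa using (hasDerivAt_id z).const_sub 1
    refine ((hasDerivAt_id z).mul ((hu z hz).div h1 hne)).congr_deriv ?_
    rw [hfe hz, hFf]
    simp only [id, Pi.div_apply, ← hzg z]
    field_simp
    ring
  have h2 := mul_cesaro_eq_sub hfd hF z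
  rw [zero_mul, sub_zero] at h2
  rw [mul_left_cancel₀ hz0 h2]
  simp [hf, hFf, discExtend_coe]

/-! ### The growth spaces are complete -/

theorem growthWeight_le_iff {γ A : ℝ} {f : 𝔻 → ℂ} {z : 𝔻} :
    growthWeight γ f z ≤ A ↔ ‖f z‖ ≤ A * (1 - ‖(z : ℂ)‖) ^ (-γ) := by
  rw [growthWeight, Real.rpow_neg (one_sub_norm_pos z).le, ← div_eq_mul_inv,
    le_div_iff₀ (Real.rpow_pos_of_pos (one_sub_norm_pos z) γ), mul_comm]

namespace GrowthSpace

variable {γ : ℝ}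

@[simp] theorem sub_apply (f g : GrowthSpace γ) (z : 𝔻) : (f - g) z = f z - g z := rfl

/-- The weight is bounded on compact subsets of the disc, so norm-Cauchy sequences converge locally
uniformly and Weierstrass' theorem makes the limit holomorphic. -/
instance : CompleteSpace (GrowthSpace γ) := by
  refine Metric.complete_of_cauchySeq_tendsto fun u hu => ?_
  have hpt : ∀ z : 𝔻, CauchySeq fun n => u n z := by
    intro z
    have hp := Real.rpow_pos_of_pos (one_sub_norm_pos z) (-γ)
    rw [Metric.cauchySeq_iff'] at hu ⊢
    intro ε hε
    obtain ⟨N, hN⟩ := hu (ε / (1 - ‖(z : ℂ)‖) ^ (-γ)) (by positivity)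
    refine ⟨N, fun n hn => ?_⟩
    have h1 := hN n hn
    rw [dist_eq_norm, lt_div_iff₀ hp] at h1
    rw [dist_eq_norm, ← sub_apply]
    exact (norm_apply_le _ z).trans_lt h1
  choose F hF using fun z => cauchySeq_tendsto_of_complete (hpt z)
  have hlim : ∀ ε > 0, ∃ N, ∀ n ≥ N, ∀ z : 𝔻, ‖u n z - F z‖ ≤ ε * (1 - ‖(z : ℂ)‖) ^ (-γ) := by
    intro ε hε
    obtain ⟨N, hN⟩ := Metric.cauchySeq_iff.1 hu ε hε
    refine ⟨N, fun n hn z => ?_⟩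
    refine le_of_tendsto ((tendsto_const_nhds.sub (hF z)).norm) ?_
    filter_upwards [eventually_ge_atTop N] with m hm
    have h1 := (hN n hn m hm).le
    rw [dist_eq_norm] at h1
    exact (norm_apply_le (u n - u m) z).trans (mul_le_mul_of_nonneg_right h1
      (Real.rpow_nonneg (one_sub_norm_pos z).le _))
  have hhol : HolomorphicOnDisc F := by
    have hloc : TendstoLocallyUniformlyOn (fun n => discExtend (u n)) (discExtend F) atTop
        (Metric.ball (0 : ℂ) 1) := by
      rw [tendstoLocallyUniformlyOn_iff_forall_isCompact Metric.isOpen_ball]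
      intro K hK hKc
      have hcont : ContinuousOn (fun z : ℂ => (1 - ‖z‖) ^ (-γ)) K :=
        ContinuousOn.rpow_const (by fun_prop) fun z hz => Or.inl (by
          have : ‖z‖ < 1 := by simpa using hK hz
          linarith)
      obtain ⟨M, hM⟩ := hKc.exists_bound_of_continuousOn hcont
      rw [Metric.tendstoUniformlyOn_iff]
      intro ε hε
      obtain ⟨N, hN⟩ := hlim (ε / (|M| + 1)) (by positivity)
      filter_upwards [eventually_ge_atTop N] with n hn z hz
      have hM' := (le_abs_self _).trans ((hM z hz).trans (le_abs_self M))
      have hz1 := hK hz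
      lift z to 𝔻 using by simpa using hz1
      rw [discExtend_coe, discExtend_coe, dist_comm, dist_eq_norm]
      refine (hN n hn z).trans_lt ?_
      calc ε / (|M| + 1) * (1 - ‖(z : ℂ)‖) ^ (-γ) ≤ ε / (|M| + 1) * |M| :=
            mul_le_mul_of_nonneg_left hM' (by positivity)
        _ < ε / (|M| + 1) * (|M| + 1) := mul_lt_mul_of_pos_left (by linarith) (by positivity)
        _ = ε := by field_simp
    exact hloc.differentiableOn (Eventually.of_forall fun n => (u n).holomorphic)
      Metric.isOpen_ball
  obtain ⟨N, hN⟩ := hlim 1 one_pos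
  have hmem : F ∈ growthSubmodule γ := by
    refine ⟨hhol, 1 + ‖u N‖, ?_⟩
    rintro _ ⟨z, rfl⟩
    rw [growthWeight_le_iff, add_mul]
    have h1 := hN N le_rfl z
    have h2 := (u N).norm_apply_le z
    have h3 := norm_sub_norm_le (F z) (u N z)
    rw [norm_sub_rev] at h3
    linarith
  obtain ⟨G, hG⟩ : ∃ G : GrowthSpace γ, ∀ z, G z = F z := ⟨⟨F, hmem⟩, fun _ => rfl⟩
  refine ⟨G, Metric.tendsto_atTop.2 fun ε hε => ?_⟩
  obtain ⟨N, hN⟩ := hlim (ε / 2) (by positivity)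
  refine ⟨N, fun n hn => ?_⟩
  rw [dist_eq_norm]
  exact (norm_le_of_growthWeight_le fun z => growthWeight_le_iff.2 (by
    rw [sub_apply, hG]
    exact hN n hn z)).trans_lt (by linarith)

/-- Evaluation at the origin. -/
noncomputable def evalZero (γ : ℝ) : GrowthSpace γ →L[ℂ] ℂ :=
  LinearMap.mkContinuous
    { toFun := fun f => f 0
      map_add' := fun _ _ => rfl
      map_smul' := fun _ _ => rfl } 1 fun f => by
    have h : ‖f 0‖ ≤ ‖f‖ := by simpa using f.norm_apply_le 0
    rw [one_mul]
    exact h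

@[simp] theorem evalZero_apply (f : GrowthSpace γ) : evalZero γ f = f 0 := rfl

end GrowthSpace

/-! ### Closedness of the little space and test functions in it. -/

theorem isClosed_growthSpaceZero (γ : ℝ) : IsClosed (GrowthSpaceZero γ : Set (GrowthSpace γ)) := by
  refine isClosed_of_closure_subset fun f hf => ?_
  change VanishingGrowth γ f
  rw [vanishingGrowth_iff]
  intro ε hε
  obtain ⟨g, hg, hfg⟩ := Metric.mem_closure_iff.1 hf (ε / 2) (by positivity)
  have hg' : VanishingGrowth γ g := hg
  obtain ⟨r, hr, H⟩ := vanishingGrowth_iff.1 hg' (ε / 2) (by positivity)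
  refine ⟨r, hr, fun z hz => ?_⟩
  rw [dist_eq_norm] at hfg
  have h1 := (f - g).growthWeight_le_norm z
  have h2 := growthWeight_add_le γ g (f - g : GrowthSpace γ) z
  have h3 : (g : 𝔻 → ℂ) + (f - g : GrowthSpace γ) = f := funext fun z => by simp
  rw [h3] at h2
  linarith [H z hz]

instance (γ : ℝ) : CompleteSpace (GrowthSpaceZero γ) :=
  (isClosed_growthSpaceZero γ).completeSpace_coe

/-- The strict gap between the exponents leaves the factor `(1 - |z|)^(γ - δ)`, which tends to `0`.
-/
theorem vanishingGrowth_of_norm_le {γ δ B : ℝ} (hδ : δ < γ) {f : 𝔻 → ℂ}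
    (h : ∀ z : 𝔻, ‖f z‖ ≤ B * (1 - ‖(z : ℂ)‖) ^ (-δ)) : VanishingGrowth γ f := by
  have hlim : Tendsto (fun x : ℝ => B * (1 - x) ^ (γ - δ)) (𝓝[<] 1) (𝓝 0) := by
    have hc : Continuous fun x : ℝ => B * (1 - x) ^ (γ - δ) :=
      continuous_const.mul ((continuous_const.sub continuous_id).rpow_const
        fun _ => Or.inr (by linarith))
    have := hc.tendsto 1
    rw [sub_self, Real.zero_rpow (by linarith), mul_zero] at this
    exact this.mono_left nhdsWithin_le_nhds
  refine squeeze_zero (growthWeight_nonneg γ f) (fun z => ?_) (hlim.comp tendsto_comap)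
  have hz := one_sub_norm_pos z
  refine (mul_le_mul_of_nonneg_left (h z) (Real.rpow_nonneg hz.le γ)).trans_eq ?_
  simp only [Function.comp_apply]
  rw [sub_eq_add_neg γ δ, Real.rpow_add hz]
  ring

theorem exists_mem_growthSpaceZero_of_norm_le {γ δ B : ℝ} (hγ : 0 < γ) (hδ : δ < γ) {f : 𝔻 → ℂ}
    (hf : HolomorphicOnDisc f) (h : ∀ z : 𝔻, ‖f z‖ ≤ B * (1 - ‖(z : ℂ)‖) ^ (-δ)) :
    ∃ e ∈ GrowthSpaceZero γ, ∀ z, (e : GrowthSpace γ) z = f z :=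
  have hv := vanishingGrowth_of_norm_le hδ h
  ⟨⟨f, mem_growthSubmodule_of_vanishing hγ hf hv⟩, hv, fun _ => rfl⟩

theorem exists_mem_growthSpaceZero_apply_zero {γ : ℝ} (hγ : 0 < γ) :
    ∃ e ∈ GrowthSpaceZero γ, (e : GrowthSpace γ) 0 = 1 := by
  obtain ⟨e, he, h⟩ := exists_mem_growthSpaceZero_of_norm_le (f := fun _ => 1) (B := 1) hγ hγ
    ((differentiableOn_const (1 : ℂ)).congr (discExtend_eqOn fun _ => rfl)) (by simp)
  exact ⟨e, he, h 0⟩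

theorem exists_mem_growthSpaceZero_one_div_one_sub {γ : ℝ} (hγ : 1 < γ) :
    ∃ e ∈ GrowthSpaceZero γ, ∀ z : 𝔻, (e : GrowthSpace γ) z = 1 / (1 - z) := by
  refine exists_mem_growthSpaceZero_of_norm_le (f := fun z => 1 / (1 - z)) (B := 1)
    (one_pos.trans hγ) hγ ?_ fun z => ?_
  · exact (DifferentiableOn.div (differentiableOn_const (1 : ℂ)) (by fun_prop)
      fun _ hw => one_sub_ne_zero_of_mem_ball hw).congr (discExtend_eqOn fun _ => rfl)
  · rw [Real.rpow_neg_one, one_mul, norm_div, norm_one, one_div]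
    refine inv_anti₀ (one_sub_norm_pos z) ?_
    simpa using norm_sub_norm_le (1 : ℂ) z

/-! ### Norm estimates for the Cesàro operator -/

/-- Integrate `v'` from the origin and divide by `|1 - z| ≥ 1 - |z|`. No growth of `f` is assumed,
so the estimate also proves that a solution of `f - C f = h` belongs to the growth space. -/
theorem norm_le_of_norm_sub_cesaro_le_of_one_lt {γ A : ℝ} (hγ : 1 < γ) {f : 𝔻 → ℂ}
    (hf : HolomorphicOnDisc f) (hf0 : f 0 = 0)
    (h : ∀ z : 𝔻, ‖f z - cesaro f z‖ ≤ A * (1 - ‖(z : ℂ)‖) ^ (-γ)) (z : 𝔻) :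
    ‖f z‖ ≤ (2 * 2 ^ γ / (γ - 1) + 1) * A * (1 - ‖(z : ℂ)‖) ^ (-γ) := by
  obtain ⟨v, g, hgd, hv, hvw, hg⟩ := exists_hasDerivAt_one_sub_mul_cesaro hf
  have hz : (z : ℂ) ∈ Metric.ball (0 : ℂ) 1 := by simpa using z.norm_lt_one
  have hgb : ∀ w ∈ Metric.ball (0 : ℂ) 1, ‖g w‖ ≤ 2 * 2 ^ γ * A * (1 - ‖w‖) ^ (-γ) :=
    fun w hw => norm_le_of_norm_mul_le (by linarith) hgd (fun w hw => by
      lift w to 𝔻 using by simpa using hw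
      rw [hg]
      exact h w) hw
  have hv0 : v 0 = 0 := by simpa [cesaro_apply_zero, hf0] using hvw 0
  have h1 := norm_primitive_le_of_one_lt hγ hv hv0 hgb hz
  have hp := one_sub_norm_pos z
  have h2 : (1 - ‖(z : ℂ)‖) * ‖cesaro f z‖ ≤ ‖v z‖ := by
    rw [hvw, norm_mul]
    refine mul_le_mul_of_nonneg_right ?_ (norm_nonneg _)
    simpa using norm_sub_norm_le (1 : ℂ) z
  rw [sub_eq_add_neg 1 γ, Real.rpow_add hp, Real.rpow_one] at h1
  have h3 : ‖cesaro f z‖ ≤ 2 * 2 ^ γ * A / (γ - 1) * (1 - ‖(z : ℂ)‖) ^ (-γ) := by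
    refine le_of_mul_le_mul_left (h2.trans (h1.trans_eq ?_)) hp
    ring
  have h4 := norm_add_le (f z - cesaro f z) (cesaro f z)
  rw [sub_add_cancel] at h4
  refine (h4.trans (add_le_add (h z) h3)).trans_eq ?_
  ring

/-- Here the factor `|1 - z|` in the bound for `v` cancels exactly. Some a priori growth bound is
indispensable: it excludes the fixed point `1 / (1 - z)`. -/
theorem norm_le_of_norm_sub_cesaro_le_of_lt_one {γ A B : ℝ} (hγ0 : 0 < γ) (hγ : γ < 1)
    {f : 𝔻 → ℂ} (hf : HolomorphicOnDisc f)
    (hB : ∀ z : 𝔻, ‖cesaro f z‖ ≤ B * (1 - ‖(z : ℂ)‖) ^ (-γ))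
    (h : ∀ z : 𝔻, ‖f z - cesaro f z‖ ≤ A * (1 - ‖(z : ℂ)‖) ^ (-γ)) (z : 𝔻) :
    ‖f z‖ ≤ (2 * 2 ^ γ / (1 - γ) + 1) * A * (1 - ‖(z : ℂ)‖) ^ (-γ) := by
  obtain ⟨v, g, hgd, hv, hvw, hg⟩ := exists_hasDerivAt_one_sub_mul_cesaro hf
  have hz : (z : ℂ) ∈ Metric.ball (0 : ℂ) 1 := by simpa using z.norm_lt_one
  have hgb : ∀ w ∈ Metric.ball (0 : ℂ) 1, ‖g w‖ ≤ 2 * 2 ^ γ * A * (1 - ‖w‖) ^ (-γ) :=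
    fun w hw => norm_le_of_norm_mul_le hγ0.le hgd (fun w hw => by
      lift w to 𝔻 using by simpa using hw
      rw [hg]
      exact h w) hw
  have h1 := norm_primitive_le_of_lt_one (B := B) hγ0 hγ hv (fun w hw => by
    lift w to 𝔻 using by simpa using hw
    rw [hvw, norm_mul, mul_comm B, mul_assoc]
    exact mul_le_mul_of_nonneg_left (hB w) (norm_nonneg _)) hgb hz
  have hp : 0 < ‖1 - (z : ℂ)‖ := norm_pos_iff.2 (one_sub_ne_zero_of_mem_ball hz)
  have h3 : ‖cesaro f z‖ ≤ 2 * 2 ^ γ * A / (1 - γ) * (1 - ‖(z : ℂ)‖) ^ (-γ) := by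
    rw [hvw, norm_mul] at h1
    refine le_of_mul_le_mul_left (h1.trans_eq ?_) hp
    ring
  have h4 := norm_add_le (f z - cesaro f z) (cesaro f z)
  rw [sub_add_cancel] at h4
  refine (h4.trans (add_le_add (h z) h3)).trans_eq ?_
  ring

/-- The derivative of `t (1 - t s)^(-γ)` is the kernel times `1 + (γ - 1) t s`, which is at least
`1` exactly because `γ ≥ 1`. The constant `1` is what makes `C` a contraction. -/
theorem integral_kernel_le_of_one_le {γ : ℝ} (hγ : 1 ≤ γ) {s : ℝ} (hs0 : 0 ≤ s) (hs1 : s < 1) :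
    ∫ t in (0 : ℝ)..1, (1 - t * s) ^ (-γ - 1) ≤ (1 - s) ^ (-γ) := by
  have hcont : ∀ p : ℝ, ContinuousOn (fun t : ℝ => (1 - t * s) ^ p) (Set.Icc 0 1) := fun p =>
    ContinuousOn.rpow_const (by fun_prop) fun _ ht => Or.inl (one_sub_mul_pos hs0 hs1 ht).ne'
  have hint : IntervalIntegrable (fun t : ℝ => (1 - t * s) ^ (-γ - 1))
      MeasureTheory.volume 0 1 := by
    apply ContinuousOn.intervalIntegrable
    rw [Set.uIcc_of_le zero_le_one]
    exact hcont _
  have hint' : IntervalIntegrable (fun t : ℝ => (1 - t * s) ^ (-γ - 1) * (1 + (γ - 1) * (t * s)))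
      MeasureTheory.volume 0 1 := by
    apply ContinuousOn.intervalIntegrable
    rw [Set.uIcc_of_le zero_le_one]
    exact (hcont _).mul (by fun_prop)
  have h2 : ∫ t in (0 : ℝ)..1, (1 - t * s) ^ (-γ - 1) * (1 + (γ - 1) * (t * s)) =
      (1 - s) ^ (-γ) := by
    have := intervalIntegral.integral_eq_sub_of_hasDerivAt (a := 0) (b := 1)
      (f := fun t : ℝ => t * (1 - t * s) ^ (-γ))
      (f' := fun t : ℝ => (1 - t * s) ^ (-γ - 1) * (1 + (γ - 1) * (t * s))) ?_ hint'
    · simpa using this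
    · intro t ht
      rw [Set.uIcc_of_le zero_le_one] at ht
      have hp := one_sub_mul_pos hs0 hs1 ht
      have h3 : HasDerivAt (fun t : ℝ => 1 - t * s) (-s) t := by
        simpa using ((hasDerivAt_id t).mul_const s).const_sub 1
      refine ((hasDerivAt_id t).mul (h3.rpow_const (p := -γ) (Or.inl hp.ne'))).congr_deriv ?_
      rw [Real.rpow_sub_one hp.ne']
      simp only [id]
      field_simp
      ring
  rw [← h2]
  refine intervalIntegral.integral_mono_on zero_le_one hint hint' fun t ht => ?_
  refine le_mul_of_one_le_right (Real.rpow_nonneg (one_sub_mul_pos hs0 hs1 ht).le _) ?_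
  have : 0 ≤ (γ - 1) * (t * s) := mul_nonneg (by linarith) (mul_nonneg ht.1 hs0)
  linarith

theorem norm_cesaroGrowth_le_one {γ : ℝ} (hγ0 : 0 < γ) (hγ : 1 ≤ γ) :
    ‖cesaroGrowth γ hγ0‖ ≤ 1 := by
  refine ContinuousLinearMap.opNorm_le_bound _ zero_le_one fun f => ?_
  rw [one_mul]
  refine GrowthSpace.norm_le_of_growthWeight_le fun z => growthWeight_le_iff.2 ?_
  rw [cesaroGrowth_apply, cesaro_eq_integral]
  have hs0 := norm_nonneg (z : ℂ)
  have hs1 := z.norm_lt_one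
  refine (intervalIntegral.norm_integral_le_of_norm_le zero_le_one
    (g := fun t : ℝ => ‖f‖ * (1 - t * ‖(z : ℂ)‖) ^ (-γ - 1))
    (Filter.Eventually.of_forall fun t ht => ?_) ?_).trans ?_
  · have ht' : t ∈ Set.Icc (0 : ℝ) 1 := ⟨ht.1.le, ht.2⟩
    obtain ⟨w, hw⟩ : ∃ w : 𝔻, (w : ℂ) = t * z :=
      ⟨Complex.UnitDisc.mk _ (by simpa using ofReal_mul_mem_ball hs1 ht'), rfl⟩
    have hn : ‖(w : ℂ)‖ = t * ‖(z : ℂ)‖ := by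
      rw [hw, norm_mul, Complex.norm_real, Real.norm_of_nonneg ht'.1]
    have hp := one_sub_mul_pos hs0 hs1 ht'
    have h1 := f.norm_apply_le w
    rw [hn] at h1
    have h2 : 1 - t * ‖(z : ℂ)‖ ≤ ‖1 - (w : ℂ)‖ := by
      rw [← hn]
      simpa using norm_sub_norm_le (1 : ℂ) w
    rw [← hw, discExtend_coe, norm_div, Real.rpow_sub_one hp.ne', ← mul_div_assoc]
    exact div_le_div₀ ((norm_nonneg _).trans h1) h1 hp h2
  · apply ContinuousOn.intervalIntegrable
    rw [Set.uIcc_of_le zero_le_one]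
    exact continuousOn_const.mul (continuousOn_kernel γ hs0 hs1)
  · rw [intervalIntegral.integral_const_mul]
    exact mul_le_mul_of_nonneg_left (integral_kernel_le_of_one_le hγ hs0 hs1) (norm_nonneg _)

theorem coe_cesaroGrowthZero_apply {γ : ℝ} (hγ : 0 < γ) (f : GrowthSpaceZero γ) :
    (cesaroGrowthZero γ hγ f : GrowthSpace γ) = cesaroGrowth γ hγ f := rfl

theorem norm_cesaroGrowthZero_le_one {γ : ℝ} (hγ0 : 0 < γ) (hγ : 1 ≤ γ) :
    ‖cesaroGrowthZero γ hγ0‖ ≤ 1 :=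
  ContinuousLinearMap.opNorm_le_bound _ zero_le_one fun f =>
    (cesaroGrowth γ hγ0).le_of_opNorm_le (norm_cesaroGrowth_le_one hγ0 hγ) f

/-! ### Fixed points and the range of `I - C` -/

theorem apply_zero_of_mem_imIdSub {γ : ℝ} {hγ : 0 < γ} {h : GrowthSpace γ}
    (hh : h ∈ imIdSub (cesaroGrowth γ hγ)) : h 0 = 0 := by
  obtain ⟨f, rfl⟩ := mem_imIdSub.1 hh
  exact sub_cesaro_apply_zero f

theorem coe_mem_imIdSub {γ : ℝ} {hγ : 0 < γ} {h : GrowthSpaceZero γ}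
    (hh : h ∈ imIdSub (cesaroGrowthZero γ hγ)) :
    (h : GrowthSpace γ) ∈ imIdSub (cesaroGrowth γ hγ) := by
  obtain ⟨f, rfl⟩ := mem_imIdSub.1 hh
  exact mem_imIdSub.2 ⟨f, rfl⟩

theorem imIdSub_cesaroGrowth_ne_top {γ : ℝ} (hγ : 0 < γ) : imIdSub (cesaroGrowth γ hγ) ≠ ⊤ := by
  intro h
  obtain ⟨e, -, he⟩ := exists_mem_growthSpaceZero_apply_zero hγ
  have : e ∈ imIdSub (cesaroGrowth γ hγ) := h ▸ Submodule.mem_top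
  exact one_ne_zero (he.symm.trans (apply_zero_of_mem_imIdSub this))

theorem imIdSub_cesaroGrowthZero_ne_top {γ : ℝ} (hγ : 0 < γ) :
    imIdSub (cesaroGrowthZero γ hγ) ≠ ⊤ := by
  intro h
  obtain ⟨e, he0, he⟩ := exists_mem_growthSpaceZero_apply_zero hγ
  have : (⟨e, he0⟩ : GrowthSpaceZero γ) ∈ imIdSub (cesaroGrowthZero γ hγ) := h ▸ Submodule.mem_top
  exact one_ne_zero (he.symm.trans (apply_zero_of_mem_imIdSub (coe_mem_imIdSub this)))

/-! ### The obstruction for `γ ≤ 1`. -/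

/-- On the positive radius the weighted modulus of `f(0) / (1 - z)` is `|f(0)| (1 - x)^(γ - 1) ≥
|f(0)|`, so it cannot vanish in the limit. Membership in the little space matters at `γ = 1`, where
`1 / (1 - z)` does lie in `A^{-1}`. -/
theorem apply_zero_eq_zero_of_fixed {γ : ℝ} {hγ0 : 0 < γ} (hγ : γ ≤ 1) {f : GrowthSpace γ}
    (hf : f ∈ GrowthSpaceZero γ) (hfix : cesaroGrowth γ hγ0 f = f) : f 0 = 0 := by
  by_contra hne
  have hf' : VanishingGrowth γ f := hf
  have hpos : 0 < ‖f 0‖ := norm_pos_iff.2 hne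
  obtain ⟨r, hr, H⟩ := vanishingGrowth_iff.1 hf' (‖f 0‖ / 2) (by positivity)
  obtain ⟨x, hx, hx1⟩ := exists_between (max_lt hr one_pos)
  have hx0 : 0 ≤ x := (le_max_right r 0).trans hx.le
  have hxn : ‖(x : ℂ)‖ = x := by rw [Complex.norm_real, Real.norm_of_nonneg hx0]
  obtain ⟨z, hz⟩ : ∃ z : 𝔻, (z : ℂ) = x := ⟨Complex.UnitDisc.mk (x : ℂ) (hxn.trans_lt hx1), rfl⟩
  have h1 := H z (by rw [hz, hxn]; exact (le_max_left r 0).trans_lt hx)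
  have hxp : 0 < 1 - x := by linarith
  have h2 : ‖f z‖ = ‖f 0‖ / (1 - x) := by
    rw [eq_of_cesaro_eq_self f.holomorphic (congrArg Subtype.val hfix) z, hz, norm_mul, norm_div,
      norm_one, show (1 : ℂ) - x = ((1 - x : ℝ) : ℂ) by push_cast; ring, Complex.norm_real,
      Real.norm_of_nonneg hxp.le, mul_one_div]
  have h3 : 1 - x ≤ (1 - x) ^ γ := by
    simpa using Real.rpow_le_rpow_of_exponent_ge hxp (by linarith) hγ
  rw [growthWeight, h2, hz, hxn] at h1
  have h4 : (1 - x) * (‖f 0‖ / (1 - x)) ≤ (1 - x) ^ γ * (‖f 0‖ / (1 - x)) :=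
    mul_le_mul_of_nonneg_right h3 (by positivity)
  rw [mul_div_cancel₀ _ hxp.ne'] at h4
  linarith

theorem apply_zero_eq_zero_of_fixed_growthSpaceZero {γ : ℝ} {hγ0 : 0 < γ} (hγ : γ ≤ 1) {f : GrowthSpaceZero γ}
    (hfix : cesaroGrowthZero γ hγ0 f = f) : (f : GrowthSpace γ) 0 = 0 :=
  apply_zero_eq_zero_of_fixed (hγ0 := hγ0) hγ f.2 (congrArg Subtype.val hfix)

theorem not_isMeanErgodic_cesaroGrowth {γ : ℝ} (hγ0 : 0 < γ) (hγ : γ ≤ 1) :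
    ¬ IsMeanErgodic (cesaroGrowth γ hγ0) := by
  rintro ⟨P, hP⟩
  obtain ⟨e, he0, he⟩ := exists_mem_growthSpaceZero_apply_zero hγ0
  have hlim := hP e
  have hmem : P e ∈ GrowthSpaceZero γ := (isClosed_growthSpaceZero γ).mem_of_tendsto hlim
    (Eventually.of_forall fun n => ergodicMean_mem_of_invariant
      (fun _ => cesaroGrowth_mem_zero hγ0) he0 n)
  have h0 := apply_zero_eq_zero_of_fixed hγ hmem (apply_eq_self_of_tendsto_ergodicMean hlim)
  have h1 : GrowthSpace.evalZero γ (P e) = 1 := by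
    refine tendsto_nhds_unique (((GrowthSpace.evalZero γ).continuous.tendsto _).comp hlim)
      (tendsto_const_nhds.congr' ?_)
    filter_upwards [eventually_ne_atTop 0] with n hn
    have := apply_zero_of_mem_imIdSub (sub_ergodicMean_mem_imIdSub (cesaroGrowth γ hγ0) hn e)
    rw [GrowthSpace.sub_apply, he, sub_eq_zero] at this
    exact this
  exact one_ne_zero (h1.symm.trans h0)

theorem not_isMeanErgodic_cesaroGrowthZero {γ : ℝ} (hγ0 : 0 < γ) (hγ : γ ≤ 1) :
    ¬ IsMeanErgodic (cesaroGrowthZero γ hγ0) := by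
  rintro ⟨P, hP⟩
  obtain ⟨e, he0, he⟩ := exists_mem_growthSpaceZero_apply_zero hγ0
  have hlim := hP ⟨e, he0⟩
  have h0 := apply_zero_eq_zero_of_fixed_growthSpaceZero hγ (apply_eq_self_of_tendsto_ergodicMean hlim)
  let E := (GrowthSpace.evalZero γ).comp (GrowthSpaceZero γ).subtypeL
  have h1 : E (P ⟨e, he0⟩) = 1 := by
    refine tendsto_nhds_unique ((E.continuous.tendsto _).comp hlim)
      (tendsto_const_nhds.congr' ?_)
    filter_upwards [eventually_ne_atTop 0] with n hn
    have := apply_zero_of_mem_imIdSub (coe_mem_imIdSub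
      (sub_ergodicMean_mem_imIdSub (cesaroGrowthZero γ hγ0) hn ⟨e, he0⟩))
    rw [Submodule.coe_sub, GrowthSpace.sub_apply, he, sub_eq_zero] at this
    exact this
  exact one_ne_zero (h1.symm.trans h0)

theorem not_isClosed_imIdSub_cesaroGrowth {γ : ℝ} {hγ0 : 0 < γ} (hγ : γ ≤ 1)
    (hpb : IsPowerBounded (cesaroGrowth γ hγ0)) :
    ¬ IsClosed (imIdSub (cesaroGrowth γ hγ0) : Set (GrowthSpace γ)) := by
  intro hcl
  obtain ⟨e, he0, he⟩ := exists_mem_growthSpaceZero_apply_zero hγ0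
  -- Taking the little space as invariant subspace forces `k(0) = 0`; for `γ = 1` a fixed point of
  -- the big space need not vanish at `0`.
  obtain ⟨k, hk, hfix, hsub⟩ := hpb.exists_fixed_sub_mem hcl (isClosed_growthSpaceZero γ)
    (fun _ => cesaroGrowth_mem_zero hγ0) he0
  have := apply_zero_of_mem_imIdSub hsub
  rw [GrowthSpace.sub_apply, he, apply_zero_eq_zero_of_fixed hγ hk hfix, sub_zero] at this
  exact one_ne_zero this

theorem not_isClosed_imIdSub_cesaroGrowthZero {γ : ℝ} {hγ0 : 0 < γ} (hγ : γ ≤ 1)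
    (hpb : IsPowerBounded (cesaroGrowthZero γ hγ0)) :
    ¬ IsClosed (imIdSub (cesaroGrowthZero γ hγ0) : Set (GrowthSpaceZero γ)) := by
  intro hcl
  obtain ⟨e, he0, he⟩ := exists_mem_growthSpaceZero_apply_zero hγ0
  obtain ⟨k, -, hfix, hsub⟩ := hpb.exists_fixed_sub_mem hcl (Z := ⊤) isClosed_univ
    (fun _ _ => Submodule.mem_top) (x := ⟨e, he0⟩) Submodule.mem_top
  have := apply_zero_of_mem_imIdSub (coe_mem_imIdSub hsub)
  rw [Submodule.coe_sub, GrowthSpace.sub_apply, he, apply_zero_eq_zero_of_fixed_growthSpaceZero hγ hfix,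
    sub_zero] at this
  exact one_ne_zero this

/-! ### Lower bounds for `I - C`, with kernel and closed range for `γ < 1`. -/

theorem exists_norm_le_norm_sub_cesaroGrowth_of_lt_one {γ : ℝ} (hγ0 : 0 < γ) (hγ : γ < 1) :
    ∃ K : ℝ, ∀ f : GrowthSpace γ, ‖f‖ ≤ K * ‖f - cesaroGrowth γ hγ0 f‖ :=
  ⟨2 * 2 ^ γ / (1 - γ) + 1, fun f => GrowthSpace.norm_le_of_growthWeight_le fun z =>
    growthWeight_le_iff.2 (norm_le_of_norm_sub_cesaro_le_of_lt_one hγ0 hγ f.holomorphic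
      (cesaroGrowth γ hγ0 f).norm_apply_le (f - cesaroGrowth γ hγ0 f).norm_apply_le z)⟩

theorem exists_norm_le_norm_sub_cesaroGrowth_of_one_lt {γ : ℝ} (hγ0 : 0 < γ) (hγ : 1 < γ) :
    ∃ K : ℝ, ∀ f : GrowthSpace γ, f 0 = 0 → ‖f‖ ≤ K * ‖f - cesaroGrowth γ hγ0 f‖ :=
  ⟨2 * 2 ^ γ / (γ - 1) + 1, fun f hf => GrowthSpace.norm_le_of_growthWeight_le fun z =>
    growthWeight_le_iff.2 (norm_le_of_norm_sub_cesaro_le_of_one_lt hγ f.holomorphic hf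
      (f - cesaroGrowth γ hγ0 f).norm_apply_le z)⟩

theorem kerIdSub_cesaroGrowth_eq_bot {γ : ℝ} (hγ0 : 0 < γ) (hγ : γ < 1) :
    kerIdSub (cesaroGrowth γ hγ0) = ⊥ := by
  obtain ⟨K, hK⟩ := exists_norm_le_norm_sub_cesaroGrowth_of_lt_one hγ0 hγ
  refine (Submodule.eq_bot_iff _).2 fun f hf => ?_
  have := hK f
  rwa [mem_kerIdSub.1 hf, sub_self, norm_zero, mul_zero, norm_le_zero_iff] at this

theorem kerIdSub_cesaroGrowthZero_eq_bot {γ : ℝ} (hγ0 : 0 < γ) (hγ : γ < 1) :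
    kerIdSub (cesaroGrowthZero γ hγ0) = ⊥ := by
  refine (Submodule.eq_bot_iff _).2 fun f hf => Subtype.ext ?_
  have : (f : GrowthSpace γ) ∈ kerIdSub (cesaroGrowth γ hγ0) :=
    mem_kerIdSub.2 (congrArg Subtype.val (mem_kerIdSub.1 hf))
  rwa [kerIdSub_cesaroGrowth_eq_bot hγ0 hγ] at this

theorem isClosed_imIdSub_cesaroGrowth_of_lt_one {γ : ℝ} (hγ0 : 0 < γ) (hγ : γ < 1) :
    IsClosed (imIdSub (cesaroGrowth γ hγ0) : Set (GrowthSpace γ)) := by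
  obtain ⟨K, hK⟩ := exists_norm_le_norm_sub_cesaroGrowth_of_lt_one hγ0 hγ
  exact isClosed_imIdSub (Y := ⊤) isClosed_univ (fun f _ => hK f)
    fun f => ⟨f, Submodule.mem_top, rfl⟩

theorem isClosed_imIdSub_cesaroGrowthZero_of_lt_one {γ : ℝ} (hγ0 : 0 < γ) (hγ : γ < 1) :
    IsClosed (imIdSub (cesaroGrowthZero γ hγ0) : Set (GrowthSpaceZero γ)) := by
  obtain ⟨K, hK⟩ := exists_norm_le_norm_sub_cesaroGrowth_of_lt_one hγ0 hγ
  exact isClosed_imIdSub (Y := ⊤) isClosed_univ (fun f _ => hK f)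
    fun f => ⟨f, Submodule.mem_top, rfl⟩

/-! ### The case `γ > 1` -/

theorem exists_sub_cesaroGrowth_eq {γ : ℝ} (hγ0 : 0 < γ) (hγ : 1 < γ) {h : GrowthSpace γ}
    (h0 : h 0 = 0) : ∃ f : GrowthSpace γ, f 0 = 0 ∧ f - cesaroGrowth γ hγ0 f = h := by
  obtain ⟨f, hf, hf0, hfh⟩ := exists_sub_cesaro_eq h.holomorphic h0
  have hb := norm_le_of_norm_sub_cesaro_le_of_one_lt hγ hf hf0 (A := ‖h‖) fun z => by
    rw [hfh]
    exact h.norm_apply_le z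
  have hmem : f ∈ growthSubmodule γ := ⟨hf, _, by
    rintro _ ⟨z, rfl⟩
    exact growthWeight_le_iff.2 (hb z)⟩
  obtain ⟨g, hg⟩ : ∃ g : GrowthSpace γ, (g : 𝔻 → ℂ) = f := ⟨⟨f, hmem⟩, rfl⟩
  refine ⟨g, by rw [hg, hf0], GrowthSpace.ext fun z => ?_⟩
  rw [GrowthSpace.sub_apply, cesaroGrowth_apply, hg, hfh]

theorem imIdSub_cesaroGrowth_eq {γ : ℝ} (hγ0 : 0 < γ) (hγ : 1 < γ) :
    (imIdSub (cesaroGrowth γ hγ0) : Set (GrowthSpace γ)) = {h : GrowthSpace γ | h 0 = 0} := by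
  ext h
  refine ⟨apply_zero_of_mem_imIdSub, fun h0 => ?_⟩
  obtain ⟨f, -, hf⟩ := exists_sub_cesaroGrowth_eq hγ0 hγ h0
  exact mem_imIdSub.2 ⟨f, hf⟩

theorem isClosed_imIdSub_cesaroGrowth_of_one_lt {γ : ℝ} (hγ0 : 0 < γ) (hγ : 1 < γ) :
    IsClosed (imIdSub (cesaroGrowth γ hγ0) : Set (GrowthSpace γ)) := by
  rw [imIdSub_cesaroGrowth_eq hγ0 hγ]
  exact isClosed_singleton.preimage (GrowthSpace.evalZero γ).continuous

theorem cesaroGrowth_one_div_one_sub {γ : ℝ} (hγ0 : 0 < γ) {φ : GrowthSpace γ}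
    (hφ : ∀ z : 𝔻, φ z = 1 / (1 - z)) : cesaroGrowth γ hγ0 φ = φ := by
  refine GrowthSpace.ext fun z => ?_
  rw [cesaroGrowth_apply]
  rcases eq_or_ne (z : ℂ) 0 with hz0 | hz0
  · have : z = 0 := by simpa using hz0
    rw [this, cesaro_apply_zero]
  -- The integrand is `(1 - z)⁻²`, so `z C φ = 1 / (1 - z) - 1 = z φ`.
  have hF : ∀ z ∈ Metric.ball (0 : ℂ) 1, HasDerivAt (fun z : ℂ => (1 - z)⁻¹)
      (discExtend φ z / (1 - z)) z := by
    intro z hz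
    have hne := one_sub_ne_zero_of_mem_ball hz
    have h1 : HasDerivAt (fun z : ℂ => 1 - z) (-1) z := by
      simpa using (hasDerivAt_id z).const_sub 1
    refine (h1.inv hne).congr_deriv ?_
    rw [discExtend_eqOn (F := fun z => 1 / (1 - z)) hφ hz]
    field_simp
  have h2 := mul_cesaro_eq_sub φ.holomorphic hF z
  have hne : 1 - (z : ℂ) ≠ 0 :=
    one_sub_ne_zero_of_mem_ball (by simpa using z.norm_lt_one)
  refine mul_left_cancel₀ hz0 (h2.trans ?_)
  rw [hφ]
  field_simp
  ring

/-- Subtracting `f(0) φ`, which stays in the little space and does not change `f - C f`, reduces to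
functions vanishing at `0`, where `I - C` is bounded below. The range need not be identified. -/
theorem isClosed_imIdSub_cesaroGrowthZero_of_one_lt {γ : ℝ} (hγ0 : 0 < γ) (hγ : 1 < γ) :
    IsClosed (imIdSub (cesaroGrowthZero γ hγ0) : Set (GrowthSpaceZero γ)) := by
  obtain ⟨K, hK⟩ := exists_norm_le_norm_sub_cesaroGrowth_of_one_lt hγ0 hγ
  obtain ⟨φ, hφ0, hφ⟩ := exists_mem_growthSpaceZero_one_div_one_sub hγ
  let E := (GrowthSpace.evalZero γ).comp (GrowthSpaceZero γ).subtypeL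
  refine isClosed_imIdSub (Y := LinearMap.ker E.toLinearMap) E.isClosed_ker
    (fun f hf => hK f hf) fun f => ?_
  have hfix : cesaroGrowthZero γ hγ0 ⟨φ, hφ0⟩ = ⟨φ, hφ0⟩ :=
    Subtype.ext (cesaroGrowth_one_div_one_sub hγ0 hφ)
  refine ⟨f - (f : GrowthSpace γ) 0 • ⟨φ, hφ0⟩, ?_, ?_⟩
  · change (f : GrowthSpace γ) 0 - (f : GrowthSpace γ) 0 * φ 0 = 0
    rw [hφ]
    simp
  · rw [map_sub, map_smul, hfix]
    abel

/-- The rank one projection `f ↦ f(0) φ`. -/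
noncomputable def evalZeroProj {γ : ℝ} (φ : GrowthSpace γ) : GrowthSpace γ →L[ℂ] GrowthSpace γ :=
  (GrowthSpace.evalZero γ).smulRight φ

theorem evalZeroProj_apply {γ : ℝ} (φ f : GrowthSpace γ) : evalZeroProj φ f = f 0 • φ := rfl

/-- The averages fix `f(0) φ`, and the remainder is `g - C g` with `‖g‖` bounded by a multiple of
`‖f‖`. The bound is stated vector by vector so that it restricts to the little space. -/
theorem exists_norm_ergodicMean_sub_le {γ : ℝ} (hγ0 : 0 < γ) (hγ : 1 < γ) {φ : GrowthSpace γ}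
    (hφ : ∀ z : 𝔻, φ z = 1 / (1 - z)) : ∃ C : ℝ, 0 ≤ C ∧ ∀ n : ℕ, n ≠ 0 → ∀ f : GrowthSpace γ,
      ‖ergodicMean (cesaroGrowth γ hγ0) n f - evalZeroProj φ f‖ ≤ C / n * ‖f‖ := by
  obtain ⟨K, hK⟩ := exists_norm_le_norm_sub_cesaroGrowth_of_one_lt hγ0 hγ
  obtain ⟨M, hM⟩ := isPowerBounded_of_norm_le_one (norm_cesaroGrowth_le_one hγ0 hγ.le)
  replace hM : ∀ n : ℕ, ‖cesaroGrowth γ hγ0 ^ n‖ ≤ M := fun n => hM ⟨n, rfl⟩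
  have hM0 : 0 ≤ M := (norm_nonneg _).trans (hM 0)
  refine ⟨2 * M * (|K| * (1 + ‖evalZeroProj φ‖)), by positivity, fun n hn f => ?_⟩
  obtain ⟨g, hg0, hg⟩ := exists_sub_cesaroGrowth_eq hγ0 hγ (h := f - evalZeroProj φ f) (by
    rw [evalZeroProj_apply, GrowthSpace.sub_apply, GrowthSpace.smul_apply, hφ]
    simp)
  have hfix : ergodicMean (cesaroGrowth γ hγ0) n (evalZeroProj φ f) = evalZeroProj φ f := by
    rw [evalZeroProj_apply, map_smul,
      ergodicMean_apply_of_fixed (cesaroGrowth_one_div_one_sub hγ0 hφ) hn]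
  have h1 := norm_ergodicMean_sub_le hM n g
  rw [hg, map_sub, hfix] at h1
  have h2 : ‖g‖ ≤ |K| * (1 + ‖evalZeroProj φ‖) * ‖f‖ := by
    have h3 := hK g hg0
    rw [hg] at h3
    have h4 : ‖f - evalZeroProj φ f‖ ≤ (1 + ‖evalZeroProj φ‖) * ‖f‖ := by
      linarith [norm_sub_le f (evalZeroProj φ f), (evalZeroProj φ).le_opNorm f]
    calc ‖g‖ ≤ |K| * ‖f - evalZeroProj φ f‖ :=
          h3.trans (mul_le_mul_of_nonneg_right (le_abs_self K) (norm_nonneg _))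
      _ ≤ |K| * ((1 + ‖evalZeroProj φ‖) * ‖f‖) := mul_le_mul_of_nonneg_left h4 (abs_nonneg K)
      _ = _ := by ring
  calc _ ≤ 2 * M * ‖g‖ / n := h1
    _ ≤ 2 * M * (|K| * (1 + ‖evalZeroProj φ‖) * ‖f‖) / n := by gcongr
    _ = _ := by ring

theorem tendsto_norm_ergodicMean_sub {γ : ℝ} (hγ0 : 0 < γ) (hγ : 1 < γ) {φ : GrowthSpace γ}
    (hφ : ∀ z : 𝔻, φ z = 1 / (1 - z)) :
    Tendsto (fun n => ‖ergodicMean (cesaroGrowth γ hγ0) n - evalZeroProj φ‖) atTop (𝓝 0) := by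
  obtain ⟨C, hC0, hC⟩ := exists_norm_ergodicMean_sub_le hγ0 hγ hφ
  refine squeeze_zero' (Eventually.of_forall fun _ => norm_nonneg _) ?_
    (tendsto_const_div_atTop_nhds_zero_nat C)
  filter_upwards [eventually_ne_atTop 0] with n hn
  exact ContinuousLinearMap.opNorm_le_bound _ (by positivity) (hC n hn)

theorem coe_ergodicMean_cesaroGrowthZero {γ : ℝ} (hγ0 : 0 < γ) (n : ℕ) (f : GrowthSpaceZero γ) :
    (ergodicMean (cesaroGrowthZero γ hγ0) n f : GrowthSpace γ) =
      ergodicMean (cesaroGrowth γ hγ0) n f := by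
  have hpow : ∀ m : ℕ, ((cesaroGrowthZero γ hγ0 ^ m) f : GrowthSpace γ) =
      (cesaroGrowth γ hγ0 ^ m) f := fun m => by
    induction m with
    | zero => rfl
    | succ m ih =>
      rw [pow_succ', pow_succ', mul_apply_eq_comp, mul_apply_eq_comp, coe_cesaroGrowthZero_apply,
        ih]
  rw [ergodicMean_apply, ergodicMean_apply, Submodule.coe_smul, Submodule.coe_sum]
  simp only [hpow]

theorem isUniformlyMeanErgodic_cesaroGrowthZero {γ : ℝ} (hγ0 : 0 < γ) (hγ : 1 < γ) :
    IsUniformlyMeanErgodic (cesaroGrowthZero γ hγ0) := by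
  obtain ⟨φ, hφ0, hφ⟩ := exists_mem_growthSpaceZero_one_div_one_sub hγ
  obtain ⟨C, hC0, hC⟩ := exists_norm_ergodicMean_sub_le hγ0 hγ hφ
  refine ⟨((evalZeroProj φ).comp (GrowthSpaceZero γ).subtypeL).codRestrict (GrowthSpaceZero γ)
    fun f => Submodule.smul_mem _ _ hφ0, ?_⟩
  refine squeeze_zero' (Eventually.of_forall fun _ => ContinuousLinearMap.opNorm_nonneg _) ?_
    (tendsto_const_div_atTop_nhds_zero_nat C)
  filter_upwards [eventually_ne_atTop 0] with n hn
  refine ContinuousLinearMap.opNorm_le_bound _ (by positivity) fun f => ?_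
  have := hC n hn f
  rw [← coe_ergodicMean_cesaroGrowthZero] at this
  exact this

/-! ### The three ranges of `γ`. -/

theorem theorem2p5 :
    -- the case `0 < γ < 1`
    (∀ (γ : ℝ) (hγ : 0 < γ), γ < 1 →
      (¬ IsPowerBounded (cesaroGrowth γ hγ) ∧ ¬ IsPowerBounded (cesaroGrowthZero γ hγ)) ∧
      (¬ IsMeanErgodic (cesaroGrowth γ hγ) ∧ ¬ IsMeanErgodic (cesaroGrowthZero γ hγ)) ∧
      (kerIdSub (cesaroGrowth γ hγ) = ⊥ ∧ kerIdSub (cesaroGrowthZero γ hγ) = ⊥) ∧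
      (IsProperClosed (imIdSub (cesaroGrowth γ hγ)) ∧
        IsProperClosed (imIdSub (cesaroGrowthZero γ hγ)))) ∧
    -- the case `γ = 1`
    ((IsPowerBounded (cesaroGrowth 1 one_pos) ∧ IsPowerBounded (cesaroGrowthZero 1 one_pos)) ∧
      (¬ IsMeanErgodic (cesaroGrowth 1 one_pos) ∧ ¬ IsMeanErgodic (cesaroGrowthZero 1 one_pos)) ∧
      (¬ IsClosed (imIdSub (cesaroGrowth 1 one_pos) : Set (GrowthSpace 1)) ∧
        ¬ IsClosed (imIdSub (cesaroGrowthZero 1 one_pos) : Set (GrowthSpaceZero 1)))) ∧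
    -- the case `γ > 1`
    (∀ (γ : ℝ) (hγ : 0 < γ), 1 < γ →
      (IsPowerBounded (cesaroGrowth γ hγ) ∧ IsPowerBounded (cesaroGrowthZero γ hγ)) ∧
      (IsUniformlyMeanErgodic (cesaroGrowth γ hγ) ∧
        IsUniformlyMeanErgodic (cesaroGrowthZero γ hγ)) ∧
      (IsProperClosed (imIdSub (cesaroGrowth γ hγ)) ∧
        IsProperClosed (imIdSub (cesaroGrowthZero γ hγ))) ∧
      (imIdSub (cesaroGrowth γ hγ) : Set (GrowthSpace γ)) = {h : GrowthSpace γ | h 0 = 0} ∧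
      -- the map `f ↦ f(0) / (1 - z)` is a continuous projection, and it is the norm limit
      ∃ P : GrowthSpace γ →L[ℂ] GrowthSpace γ,
        (∀ (f : GrowthSpace γ) (z : 𝔻), P f z = f 0 * (1 / (1 - (z : ℂ)))) ∧
        P ∘L P = P ∧
        Tendsto (fun n => ‖ergodicMean (cesaroGrowth γ hγ) n - P‖) atTop (𝓝 0)) := by
  refine ⟨fun γ hγ0 hγ => ?_, ?_, fun γ hγ0 hγ => ?_⟩
  · have hcl := isClosed_imIdSub_cesaroGrowth_of_lt_one hγ0 hγ
    have hcl0 := isClosed_imIdSub_cesaroGrowthZero_of_lt_one hγ0 hγ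
    exact ⟨⟨fun h => not_isClosed_imIdSub_cesaroGrowth hγ.le h hcl,
        fun h => not_isClosed_imIdSub_cesaroGrowthZero hγ.le h hcl0⟩,
      ⟨not_isMeanErgodic_cesaroGrowth hγ0 hγ.le, not_isMeanErgodic_cesaroGrowthZero hγ0 hγ.le⟩,
      ⟨kerIdSub_cesaroGrowth_eq_bot hγ0 hγ, kerIdSub_cesaroGrowthZero_eq_bot hγ0 hγ⟩,
      ⟨hcl, imIdSub_cesaroGrowth_ne_top hγ0⟩, ⟨hcl0, imIdSub_cesaroGrowthZero_ne_top hγ0⟩⟩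
  · have hpb := isPowerBounded_of_norm_le_one (norm_cesaroGrowth_le_one one_pos le_rfl)
    have hpb0 := isPowerBounded_of_norm_le_one (norm_cesaroGrowthZero_le_one one_pos le_rfl)
    exact ⟨⟨hpb, hpb0⟩,
      ⟨not_isMeanErgodic_cesaroGrowth one_pos le_rfl,
        not_isMeanErgodic_cesaroGrowthZero one_pos le_rfl⟩,
      not_isClosed_imIdSub_cesaroGrowth le_rfl hpb,
      not_isClosed_imIdSub_cesaroGrowthZero le_rfl hpb0⟩
  · obtain ⟨φ, -, hφ⟩ := exists_mem_growthSpaceZero_one_div_one_sub hγ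
    have hlim := tendsto_norm_ergodicMean_sub hγ0 hγ hφ
    refine ⟨⟨isPowerBounded_of_norm_le_one (norm_cesaroGrowth_le_one hγ0 hγ.le),
        isPowerBounded_of_norm_le_one (norm_cesaroGrowthZero_le_one hγ0 hγ.le)⟩,
      ⟨⟨_, hlim⟩, isUniformlyMeanErgodic_cesaroGrowthZero hγ0 hγ⟩,
      ⟨⟨isClosed_imIdSub_cesaroGrowth_of_one_lt hγ0 hγ, imIdSub_cesaroGrowth_ne_top hγ0⟩,
        isClosed_imIdSub_cesaroGrowthZero_of_one_lt hγ0 hγ, imIdSub_cesaroGrowthZero_ne_top hγ0⟩,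
      imIdSub_cesaroGrowth_eq hγ0 hγ, evalZeroProj φ, fun f z => ?_, ?_, hlim⟩
    · rw [evalZeroProj_apply, GrowthSpace.smul_apply, hφ]
    · refine ContinuousLinearMap.ext fun f => GrowthSpace.ext fun z => ?_
      rw [ContinuousLinearMap.comp_apply, evalZeroProj_apply, evalZeroProj_apply,
        GrowthSpace.smul_apply, GrowthSpace.smul_apply, hφ 0]
      simp
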